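/- Let $f:\mathbb{R}^n\times\mathbb{R}\to\mathbb{R}^n$, $h:\mathbb{R}^n\to\mathbb{R}$, $\beta:\mathbb{R}^n\times\mathbb{R}\to\mathbb{R}$ and $l:\mathbb{R}\to\mathbb{R}^n$ be $C^\infty$, where for all $\theta\in\mathbb R$ and $x\in\mathbb R^n$ one has $f(x,\beta(x,\theta))=x$ if and only if $x=l(\theta)$. Let $\theta^*\in\mathbb{R}$ satisfy $(h\circ l)'(\theta^*)=0$ and $(h\circ l)''(\theta^*)<0$, and put $\varsigma(s)=h(l(\theta^*+s))-h(l(\theta^*))$. Let $\varrho,w_1,w_2,\sigma,\sigma_1>0$ and $M\ge 0$. Let $(v_k)$ be i.i.d. $N(0,\sigma^2)$ and $W_k=(-M)\vee Z_k\wedge M$ with $(Z_k)$ i.i.d. $N(0,\sigma_1^2)$, the sequences $(v_k)$ and $(W_k)$ being independent. For $a,\epsilon>0$ consider the reduced system $$\tilde\theta_{k+1}=\tilde\theta_k+\epsilon\varrho\,\xi_k,$$ $$\xi_{k+1}=\xi_k-\epsilon w_1\xi_k+\epsilon w_1\big(\varsigma(\tilde\theta_k+a\sin v_{k+1})-\tilde\zeta_k+W_{k+1}\big)\sin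 v_{k+1},$$ $$\tilde\zeta_{k+1}=\tilde\zeta_k-\epsilon w_2\tilde\zeta_k+\epsilon w_2\big(\varsigma(\tilde\theta_k+a\sin v_{k+1})+W_{k+1}\big),$$ written $X_{k+1}=X_k+\epsilon F_a(X_k,v_{k+1},W_{k+1})$ with $X_k=(\tilde\theta_k,\xi_k,\tilde\zeta_k)$. Its average system is $\bar X_{k+1}=\bar X_k+\epsilon\bar F_a(\bar X_k)$, where $\bar F_a(x)=\mathbb{E}\,F_a(x,v_1,W_1)$, and an average equilibrium is a zero of $\bar F_a$. Then there are $a^*>0$ and functions $a\mapsto\tilde\theta^{\rm e}(a)$, $a\mapsto\tilde\zeta^{\rm e}(a)$ with, as $a\to0^+$, $$\tilde\theta^{\rm e}(a)=-\frac{\varsigma'''(0)\,(3-4e^{-2\sigma^2}+e^{-8\sigma^2})}{24\,\varsigma''(0)\,(1-e^{-2\sigma^2})}\,a^2+O(a^3),\qquad \tilde\zeta^{\rm e}(a)=\frac{\varsigma''(0)(1-e^{-2\sigma^2})}{4}\,a^2+O(a^3),$$ such that for every $0<a<a^*$ the point $e_a=(\tilde\theta^{\rm e}(a),0,\tilde\zeta^{\rm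 e}(a))$ is an average equilibrium and is weakly exponentially stable for the reduced system, in the following sense. There are $\epsilon_0>0$ and constants $r_\epsilon>0$, $c_\epsilon>0$, $0<\gamma_\epsilon<1$ for $0<\epsilon<\epsilon_0$, which satisfy $r_\epsilon\ge r_0$, $c_\epsilon\le c_0$ and $\gamma_\epsilon\le e^{-\kappa\epsilon}$ for some $r_0,c_0,\kappa>0$ that do not depend on $\epsilon$, such that, with $\Delta^\epsilon_k=X_k-e_a$, for all deterministic initial conditions with $|\Delta_0^\epsilon|<r_\epsilon$ for all $0<\epsilon<\epsilon_0$ and for every $\delta>0$, $$\lim_{\epsilon\to0}\inf\{k\in\mathbb{N}:|\Delta_k^\epsilon|>c_\epsilon|\Delta_0^\epsilon|\gamma_\epsilon^k+\delta\}=+\infty\quad\text{a.s.},$$ and, for every $N\in\mathbb{N}$, $$\lim_{\epsilon\to0}P\{|\Delta_k^\epsilon|\le c_\epsilon|\Delta_0^\epsilon|\gamma_\epsilon^k+\delta\ \text{ for all } k=0,1,\dots,\lfloor N/\epsilon\rfloor\}=1.$$ -/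

import Mathlib

open MeasureTheory ProbabilityTheory Filter Topology Asymptotics
open scoped NNReal

noncomputable section

namespace StochES

/-- The truncation `(-M) ∨ z ∧ M` of a real number to the interval `[-M, M]`. -/
def truncate (M z : ℝ) : ℝ := max (-M) (min z M)

/-- The shifted output equilibrium map `ς(s) = h(l(θ* + s)) - h(l(θ*))`. -/
def shiftedMap {E : Type*} (h : E → ℝ) (l : ℝ → E) (θs : ℝ) (s : ℝ) : ℝ :=
  h (l (θs + s)) - h (l θs)

/-- The vector field of the reduced system in the state `x = (θ̃, ξ, ζ̃)`, with probing signal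
value `y` and measurement noise value `w`. -/
def reducedField (ς : ℝ → ℝ) (ϱ w₁ w₂ a : ℝ) (x : EuclideanSpace ℝ (Fin 3)) (y w : ℝ) :
    EuclideanSpace ℝ (Fin 3) :=
  !₂[ϱ * x 1,
    -w₁ * x 1 + w₁ * (ς (x 0 + a * Real.sin y) - x 2 + w) * Real.sin y,
    -w₂ * x 2 + w₂ * (ς (x 0 + a * Real.sin y) + w)]

/-- The trajectory of the reduced system: `X 0 = x₀` and
`X (k+1) = X k + ε F(X k, v (k+1), W (k+1))`, with `F` the vector field `reducedField`. -/
def reducedTraj (ς : ℝ → ℝ) (ϱ w₁ w₂ a ε : ℝ) (v W : ℕ → ℝ) (x₀ : EuclideanSpace ℝ (Fin 3)) :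
    ℕ → EuclideanSpace ℝ (Fin 3)
  | 0 => x₀
  | k + 1 => reducedTraj ς ϱ w₁ w₂ a ε v W x₀ k +
      ε • reducedField ς ϱ w₁ w₂ a (reducedTraj ς ϱ w₁ w₂ a ε v W x₀ k) (v (k + 1)) (W (k + 1))

/-- The average vector field: the integral of `reducedField` against the invariant law of
`(v, W)`, where `v ∼ N(0, σ²)` and `W` is an independent `N(0, σ₁²)` variable truncated
to `[-M, M]`. -/
def averageField (ς : ℝ → ℝ) (ϱ w₁ w₂ a : ℝ) (σ σ₁ : ℝ≥0) (M : ℝ)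
    (x : EuclideanSpace ℝ (Fin 3)) : EuclideanSpace ℝ (Fin 3) :=
  ∫ p : ℝ × ℝ, reducedField ς ϱ w₁ w₂ a x p.1 p.2
    ∂((gaussianReal 0 (σ ^ 2)).prod ((gaussianReal 0 (σ₁ ^ 2)).map (truncate M)))

/-- Equilibria of the average system `X̄ (k+1) = X̄ k + ε F̄(X̄ k)` (the same for all `ε > 0`). -/
def IsAverageEquilibrium (ς : ℝ → ℝ) (ϱ w₁ w₂ a : ℝ) (σ σ₁ : ℝ≥0) (M : ℝ)
    (x : EuclideanSpace ℝ (Fin 3)) : Prop :=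
  averageField ς ϱ w₁ w₂ a σ σ₁ M x = 0

/-- The first time `k` at which `b k < |Δ k|`, equal to `⊤` if there is none. -/
def firstExit (Δ : ℕ → EuclideanSpace ℝ (Fin 3)) (b : ℕ → ℝ) : ℕ∞ :=
  ⨅ (k : ℕ) (_ : b k < ‖Δ k‖), (k : ℕ∞)

end StochES

end

/-! Averaging along a fixed noise path. Only `sin v` and the truncated `W` enter the recursion, so
the driving noise is i.i.d. in a compact rectangle. The strong law in a Banach space of continuous
functions makes the centred sums `S_k(x) = ∑_{i<k} (F_i(x) - F̄(x))` sublinear in `k`, uniformly on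
a ball, together with their Lipschitz constants (`ae_uniform_lln`, `ae_centred_sums_sublinear`).
Hence `ε S_k` is uniformly small for `k ≤ N / ε`. The corrected path `Z_k = X_k - ε S_k(X_k)`
follows the averaged Euler scheme up to an error `o(ε)` per step. If one Euler step contracts by `1
- κ ε`, these errors add up to `o(1)`, which gives the decay estimate
(`pathwise_exponential_decay`). It holds almost surely for all small `ε`; the exit-time limit and
the limit in probability both follow.

The average field is `(ϱ ξ, -w₁ ξ + w₁ g(θ), -w₂ ζ + w₂ k(θ))` with `g(θ) = E[ς(θ + a s) s]`, `k(θ)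
= E[ς(θ + a s)]`, `s = sin v`: the terms in `W` and `ζ s` average out. An equilibrium thus needs
`g(θ) = 0`, `ξ = 0`, `ζ = k(θ)`. Odd moments of `s` vanish, so with `b₂ = ς''(0)`, `b₃ = ς'''(0)`,
`m_j = E s^j`, Taylor expansion gives `g(θ) ≈ b₂ m₂ a θ + b₃ m₄ a³ / 6` for `θ` of order `a²`; the
intermediate value theorem then yields a root with error `O(a³)` (`exists_zero_expansion`). There
`g' ≈ b₂ m₂ a < 0`, so the linearization is stable. An explicit quadratic Lyapunov function
(`exists_lyapunov_map`) turns this into the Euler contraction (`exists_euler_contraction`). -/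

namespace StochES

/-! ### Uniform law of large numbers and differentiation under the expectation -/

/-- A sequence whose averages converge grows linearly up to a sublinear error. -/
theorem exists_norm_sub_smul_le_of_tendsto {G : Type*} [NormedAddCommGroup G] [NormedSpace ℝ G]
    {S : ℕ → G} {I : G} (h : Tendsto (fun n : ℕ => (n : ℝ)⁻¹ • S n) atTop (𝓝 I))
    {η : ℝ} (hη : 0 < η) : ∃ C : ℝ, ∀ k : ℕ, ‖S k - (k : ℝ) • I‖ ≤ η * k + C := by
  obtain ⟨n₀, hn₀⟩ := Metric.tendsto_atTop.1 h η hη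
  -- `C` absorbs the finitely many early terms; the `+ 1` puts `k = 0` among them, so that the other
  -- case may divide by `k`.
  refine ⟨∑ k ∈ Finset.range (n₀ + 1), ‖S k - (k : ℝ) • I‖, fun k => ?_⟩
  by_cases hk : k < n₀ + 1
  · have := Finset.single_le_sum (f := fun k : ℕ => ‖S k - (k : ℝ) • I‖)
      (fun i _ => norm_nonneg _) (Finset.mem_range.2 hk)
    have h2 : 0 ≤ η * k := by positivity

    linarith
  · have hk0 : (0 : ℝ) < k := by
      have : 0 < k := by omega
      exact_mod_cast this
    have h1 := hn₀ k (by omega)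
    rw [dist_eq_norm] at h1
    have h2 : S k - (k : ℝ) • I = (k : ℝ) • ((k : ℝ)⁻¹ • S k - I) := by
      rw [smul_sub, smul_smul, mul_inv_cancel₀ hk0.ne', one_smul]
    have h3 : 0 ≤ ∑ k ∈ Finset.range (n₀ + 1), ‖S k - (k : ℝ) • I‖ :=
      Finset.sum_nonneg fun _ _ => norm_nonneg _
    rw [h2, norm_smul, Real.norm_of_nonneg hk0.le]
    nlinarith

/-- A uniform strong law of large numbers over a compact parameter set. -/
theorem ae_uniform_lln {Ω E G Y : Type*} [MeasurableSpace Ω] {P : Measure Ω}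
    [IsProbabilityMeasure P] [NormedAddCommGroup E] [NormedAddCommGroup G] [NormedSpace ℝ G]
    [CompleteSpace G] [TopologicalSpace Y] [SecondCountableTopology Y] [MeasurableSpace Y]
    [OpensMeasurableSpace Y] {K : Set E} (hK : IsCompact K) {g : E → Y → G}
    (hg : Continuous (Function.uncurry g)) {U : ℕ → Ω → Y} (hU : ∀ k, Measurable (U k))
    (hind : Pairwise fun i j => IndepFun (U i) (U j) P)
    (hid : ∀ k, IdentDistrib (U k) (U 0) P P) {Q : Set Y} (hQ : IsCompact Q)
    (hUQ : ∀ k ω, U k ω ∈ Q) :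
    ∀ᵐ ω ∂P, ∀ η : ℝ, 0 < η → ∃ C : ℝ, ∀ k : ℕ, ∀ x ∈ K,
      ‖∑ i ∈ Finset.range k, g x (U i ω) - (k : ℝ) • ∫ ω', g x (U 0 ω') ∂P‖ ≤ η * k + C := by
  -- Uniformity over `K` comes from the strong law for random elements of the Banach space `C(K,
  -- G)`. This space may be nonseparable; strong measurability comes from second countability of
  -- `Y`.
  have : CompactSpace K := isCompact_iff_compactSpace.1 hK
  let _ : MeasurableSpace C(K, G) := borel _
  have : BorelSpace C(K, G) := ⟨rfl⟩
  let gc : C(Y, C(K, G)) := ContinuousMap.curry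
    ⟨fun p : Y × K => g p.2 p.1, hg.comp (by fun_prop : Continuous fun p : Y × K => ((p.2 : E), p.1))⟩
  have hgc : Measurable gc := gc.continuous.measurable
  have hint : Integrable (fun ω => gc (U 0 ω)) P := by
    obtain ⟨B, hB⟩ := (hQ.image gc.continuous).isBounded.exists_norm_le
    refine Integrable.of_bound
      (gc.continuous.stronglyMeasurable.comp_measurable (hU 0)).aestronglyMeasurable B ?_
    exact Eventually.of_forall fun ω => hB _ ⟨_, hUQ 0 ω, rfl⟩
  have hlln := strong_law_ae (μ := P) (fun k ω => gc (U k ω)) hint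
    (fun i j hij => (hind hij).comp hgc hgc) (fun i => (hid i).comp hgc)
  filter_upwards [hlln] with ω hω η hη
  obtain ⟨C, hC⟩ := exists_norm_sub_smul_le_of_tendsto hω hη
  refine ⟨C, fun k x hx => ?_⟩
  refine le_trans ?_ (hC k)
  have := ContinuousMap.norm_coe_le_norm
    (∑ i ∈ Finset.range k, gc (U i ω) - (k : ℝ) • ∫ ω', gc (U 0 ω') ∂P) (⟨x, hx⟩ : K)
  rw [ContinuousMap.sub_apply, ContinuousMap.smul_apply, ContinuousMap.integral_apply hint,
    ContinuousMap.sum_apply] at this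
  exact this

/-- Differentiation under the expectation for compactly valued noise. -/
theorem hasFDerivAt_expectation {Ω E G Y : Type*} [MeasurableSpace Ω] {P : Measure Ω}
    [IsProbabilityMeasure P] [NormedAddCommGroup E] [NormedSpace ℝ E] [ProperSpace E]
    [NormedAddCommGroup G] [NormedSpace ℝ G]
    [TopologicalSpace Y] [SecondCountableTopology Y] [MeasurableSpace Y]
    [OpensMeasurableSpace Y] {g : E → Y → G} {g' : E → Y → E →L[ℝ] G}
    (hg : Continuous (Function.uncurry g)) (hg' : Continuous (Function.uncurry g'))
    (hd : ∀ x y, HasFDerivAt (fun x => g x y) (g' x y) x)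
    {U : Ω → Y} (hU : Measurable U) {Q : Set Y} (hQ : IsCompact Q) (hUQ : ∀ ω, U ω ∈ Q) (x : E) :
    HasFDerivAt (fun x => ∫ ω, g x (U ω) ∂P) (∫ ω, g' x (U ω) ∂P) x := by
  have hgx : ∀ x, Continuous (g x) := fun x =>
    hg.comp (by fun_prop : Continuous fun y : Y => (x, y))
  have hgx' : ∀ x, Continuous (g' x) := fun x =>
    hg'.comp (by fun_prop : Continuous fun y : Y => (x, y))
  have hm : ∀ x, AEStronglyMeasurable (fun ω => g x (U ω)) P := fun x =>
    ((hgx x).stronglyMeasurable.comp_measurable hU).aestronglyMeasurable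
  obtain ⟨B, hB⟩ := (hQ.image (hgx x)).isBounded.exists_norm_le
  obtain ⟨B', hB'⟩ :=
    (((isCompact_closedBall x 1).prod hQ).image hg').isBounded.exists_norm_le
  refine hasFDerivAt_integral_of_dominated_of_fderiv_le (𝕜 := ℝ)
    (F := fun x ω => g x (U ω)) (F' := fun x ω => g' x (U ω)) (bound := fun _ => B')
    (Metric.closedBall_mem_nhds x one_pos)
    (Eventually.of_forall hm) ?_ ?_ ?_ (integrable_const _) ?_
  · exact Integrable.of_bound (hm x) B (Eventually.of_forall fun ω => hB _ ⟨_, hUQ ω, rfl⟩)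
  · exact ((hgx' x).stronglyMeasurable.comp_measurable hU).aestronglyMeasurable
  · exact Eventually.of_forall fun ω z hz => hB' _ ⟨(z, U ω), ⟨hz, hUQ ω⟩, rfl⟩
  · exact Eventually.of_forall fun ω z _ => hd z _

/-- The centred sums of a smooth field along i.i.d. noise are almost surely sublinear, and so are
their Lipschitz constants, on each closed ball. -/
theorem ae_centred_sums_sublinear {Ω E G Y : Type*} [MeasurableSpace Ω] {P : Measure Ω}
    [IsProbabilityMeasure P] [NormedAddCommGroup E] [NormedSpace ℝ E] [ProperSpace E]
    [NormedAddCommGroup G] [NormedSpace ℝ G] [CompleteSpace G]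
    [TopologicalSpace Y] [SecondCountableTopology Y] [MeasurableSpace Y]
    [OpensMeasurableSpace Y] {g : E → Y → G} {g' : E → Y → E →L[ℝ] G}
    (hg : Continuous (Function.uncurry g)) (hg' : Continuous (Function.uncurry g'))
    (hd : ∀ x y, HasFDerivAt (fun x => g x y) (g' x y) x)
    {U : ℕ → Ω → Y} (hU : ∀ k, Measurable (U k))
    (hind : Pairwise fun i j => IndepFun (U i) (U j) P)
    (hid : ∀ k, IdentDistrib (U k) (U 0) P P) {Q : Set Y} (hQ : IsCompact Q)
    (hUQ : ∀ k ω, U k ω ∈ Q) (e : E) (R : ℝ) :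
    ∀ᵐ ω ∂P, ∀ η : ℝ, 0 < η → ∃ C : ℝ, ∀ k : ℕ, ∀ x ∈ Metric.closedBall e R,
      ‖∑ i ∈ Finset.range k, (g x (U i ω) - ∫ ω', g x (U 0 ω') ∂P)‖ ≤ η * k + C ∧
      ∀ y ∈ Metric.closedBall e R,
        ‖∑ i ∈ Finset.range k, (g y (U i ω) - ∫ ω', g y (U 0 ω') ∂P) -
          ∑ i ∈ Finset.range k, (g x (U i ω) - ∫ ω', g x (U 0 ω') ∂P)‖ ≤
            (η * k + C) * ‖y - x‖ := by
  filter_upwards [ae_uniform_lln (isCompact_closedBall e R) hg hU hind hid hQ hUQ,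
    ae_uniform_lln (isCompact_closedBall e R) hg' hU hind hid hQ hUQ] with ω h1 h2 η hη
  obtain ⟨C₁, hC₁⟩ := h1 η hη
  obtain ⟨C₂, hC₂⟩ := h2 η hη
  refine ⟨max C₁ C₂, fun k x hx => ⟨?_, fun y hy => ?_⟩⟩
  · have := hC₁ k x hx
    rw [Finset.sum_sub_distrib, Finset.sum_const, Finset.card_range, ← Nat.cast_smul_eq_nsmul ℝ]
    linarith [le_max_left C₁ C₂]
  -- The derivative of the centred sum is the centred sum of `g'`, to which the same uniform law
  -- applies; the mean value inequality on the ball converts this into a Lipschitz constant.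
  · refine Convex.norm_image_sub_le_of_norm_hasFDerivWithin_le (𝕜 := ℝ)
      (f := fun x => ∑ i ∈ Finset.range k, (g x (U i ω) - ∫ ω', g x (U 0 ω') ∂P))
      (f' := fun x => ∑ i ∈ Finset.range k, (g' x (U i ω) - ∫ ω', g' x (U 0 ω') ∂P))
      (fun z _ => ?_) (fun z hz => ?_) (convex_closedBall e R) hx hy
    · exact (HasFDerivAt.fun_sum fun i _ => (hd z (U i ω)).sub
        (hasFDerivAt_expectation hg hg' hd (hU 0) hQ (hUQ 0) z)).hasFDerivWithinAt
    · have := hC₂ k z hz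
      rw [Finset.sum_sub_distrib, Finset.sum_const, Finset.card_range, ← Nat.cast_smul_eq_nsmul ℝ]
      linarith [le_max_right C₁ C₂]

/-! ### Pathwise averaging by a near-identity change of variables -/

/-- A linear recursion with contraction factor `q = 1 - κ ε` and input of size `ε b` stays below
`q ^ k * p 0 + b / κ`. -/
theorem le_pow_mul_add_of_recursion {κ ε b : ℝ} (hκ : 0 < κ) (hκε : κ * ε ≤ 1)
    {p q : ℝ} {k : ℕ} {p₀ : ℝ} (hp : p ≤ (1 - κ * ε) ^ k * p₀ + b / κ)
    (hq : q ≤ (1 - κ * ε) * p + ε * b) : q ≤ (1 - κ * ε) ^ (k + 1) * p₀ + b / κ := by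
  have h1 : (1 - κ * ε) * p ≤ (1 - κ * ε) * ((1 - κ * ε) ^ k * p₀ + b / κ) :=
    mul_le_mul_of_nonneg_left hp (by linarith)
  have h2 : (1 - κ * ε) * ((1 - κ * ε) ^ k * p₀ + b / κ) + ε * b =
      (1 - κ * ε) ^ (k + 1) * p₀ + b / κ := by
    field_simp
    ring
  linarith

/-- One step of the corrected trajectory `Z = X - ε S(X)`. -/
theorem corrected_step {E H : Type*} [NormedAddCommGroup E] [NormedSpace ℝ E]
    [NormedAddCommGroup H] [NormedSpace ℝ H] {T : E →L[ℝ] H} {e : E} {Φ : E → E}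
    {L B D q ε : ℝ} (hε : 0 ≤ ε) (hD : 0 ≤ D)
    {X X' Z Z' FX SX SX' S'X : E} (hX' : X' = X + ε • FX) (hZ : Z = X - ε • SX)
    (hZ' : Z' = X' - ε • SX') (hS : S'X = SX + (FX - Φ X))
    (hT : ‖T (Z - e + ε • Φ Z)‖ ≤ q * ‖T (Z - e)‖)
    (hL : ‖Φ X - Φ Z‖ ≤ L * ‖X - Z‖) (hL0 : 0 ≤ L) (hB : ‖FX‖ ≤ B)
    (hSX : ‖ε • SX‖ ≤ D) (hSS : ‖ε • (SX' - S'X)‖ ≤ D * ‖X' - X‖) :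
    ‖T (Z' - e)‖ ≤ q * ‖T (Z - e)‖ + ε * (‖T‖ * ((L + B) * D)) := by
  -- The increment of the sum removes `FX - Φ X`, leaving the averaged drift `Φ X`. What remains is
  -- the cost of moving `Φ` from `X` to `Z` and of moving the sum from `X` to `X'`.
  have h1 : Z' - e = (Z - e + ε • Φ Z) + (ε • (Φ X - Φ Z) - ε • (SX' - S'X)) := by
    rw [hZ', hX', hZ, hS]
    module
  have h2 : ‖ε • (Φ X - Φ Z)‖ ≤ ε * (L * D) := by
    rw [norm_smul, Real.norm_of_nonneg hε]
    refine mul_le_mul_of_nonneg_left (hL.trans (mul_le_mul_of_nonneg_left ?_ hL0)) hε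
    rw [hZ, sub_sub_cancel]
    exact hSX
  have h3 : ‖X' - X‖ ≤ ε * B := by
    rw [hX', add_sub_cancel_left, norm_smul, Real.norm_of_nonneg hε]
    exact mul_le_mul_of_nonneg_left hB hε
  have h4 : ‖ε • (SX' - S'X)‖ ≤ ε * (B * D) := by
    refine hSS.trans ((mul_le_mul_of_nonneg_left h3 hD).trans (le_of_eq (by ring)))
  rw [h1, map_add]
  refine (norm_add_le _ _).trans (add_le_add hT ?_)
  refine (T.le_opNorm _).trans ?_
  have h5 := (norm_sub_le (ε • (Φ X - Φ Z)) (ε • (SX' - S'X))).trans (add_le_add h2 h4)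
  calc ‖T‖ * _ ≤ ‖T‖ * (ε * (L * D) + ε * (B * D)) :=
        mul_le_mul_of_nonneg_left h5 (norm_nonneg _)
    _ = _ := by ring

/-- Averaging on time intervals of length `N / ε` for a fixed noise path: if the centred sums of
the field `F` are sublinear and the averaged field `Φ` is a contraction towards `e` for the norm
`‖T ·‖`, then the trajectory follows the exponential decay up to an arbitrarily small error. -/
theorem pathwise_exponential_decay {E H : Type*} [NormedAddCommGroup E] [NormedSpace ℝ E]
    [NormedAddCommGroup H] [NormedSpace ℝ H] {T : E →L[ℝ] H} {e : E} {Φ : E → E}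
    {m κ R L B ε₁ : ℝ} (hm : 0 < m) (hmT : ∀ x, m * ‖x‖ ≤ ‖T x‖) (hκ : 0 < κ) (hR : 0 < R)
    (hL0 : 0 ≤ L) (hB0 : 0 ≤ B) (hε₁ : 0 < ε₁)
    (hL : ∀ x ∈ Metric.closedBall e R, ∀ y ∈ Metric.closedBall e R, ‖Φ x - Φ y‖ ≤ L * ‖x - y‖)
    (hT : ∀ ε, 0 < ε → ε < ε₁ → ∀ x ∈ Metric.closedBall e R,
      ‖T (x - e + ε • Φ x)‖ ≤ (1 - κ * ε) * ‖T (x - e)‖)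
    {F : ℕ → E → E} (hB : ∀ k, ∀ x ∈ Metric.closedBall e R, ‖F k x‖ ≤ B)
    (hS : ∀ η : ℝ, 0 < η → ∃ C : ℝ, ∀ k : ℕ, ∀ x ∈ Metric.closedBall e R,
      ‖∑ i ∈ Finset.range k, (F i x - Φ x)‖ ≤ η * k + C ∧
      ∀ y ∈ Metric.closedBall e R,
        ‖∑ i ∈ Finset.range k, (F i y - Φ y) - ∑ i ∈ Finset.range k, (F i x - Φ x)‖ ≤
            (η * k + C) * ‖y - x‖)
    {r : ℝ} (hr : ‖T‖ / m * r ≤ R / 4) (hrR : r ≤ R / 4)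
    (N : ℕ) {δ : ℝ} (hδ : 0 < δ) :
    ∃ ε₂ : ℝ, 0 < ε₂ ∧ ∀ ε, 0 < ε → ε < ε₂ → ∀ X : ℕ → E,
      (∀ k, X (k + 1) = X k + ε • F k (X k)) → ‖X 0 - e‖ ≤ r → ∀ k : ℕ, k ≤ ⌊(N : ℝ) / ε⌋₊ →
        ‖X k - e‖ ≤ ‖T‖ / m * ‖X 0 - e‖ * (1 - κ * ε) ^ k + δ := by
  -- the admissible size `D` of the correction
  obtain ⟨D, hD0, hD1, hD2⟩ : ∃ D : ℝ, 0 < D ∧ ‖T‖ * ((L + B) * D) / κ / m + D ≤ R / 4 ∧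
      ‖T‖ * ((L + B) * D) / κ / m + D ≤ δ := by
    -- The first summand is the accumulated error `b / κ / m` per unit of `D`; the `1` accounts for
    -- the distance between `X` and the corrected path.
    set c : ℝ := ‖T‖ * (L + B) / κ / m + 1 with hc
    have hc0 : 0 < c := by positivity
    refine ⟨min (R / 4) δ / c, by positivity, ?_, ?_⟩
    all_goals
      have h1 : ‖T‖ * ((L + B) * (min (R / 4) δ / c)) / κ / m + min (R / 4) δ / c =
          min (R / 4) δ / c * c := by rw [hc]; ring
      rw [h1, div_mul_cancel₀ _ hc0.ne']
    · exact min_le_left _ _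
    · exact min_le_right _ _
  -- With this slope, the linear part of `ε S_k` costs at most `D / 2`, since `ε k ≤ N + 1`; the
  -- constant part costs `ε C ≤ D / 2`.
  obtain ⟨C, hC⟩ := hS (D / (2 * (N + 1))) (by positivity)
  have heR : e ∈ Metric.closedBall e R := Metric.mem_closedBall_self hR.le
  have hC0 : 0 ≤ C := by
    have := (hC 0 e heR).1
    simp at this
    exact this
  -- In order: validity of the contraction; `κ ε ≤ 1`; `ε k ≤ N + 1`; one step moves by at most `R /
  -- 4`; `ε C ≤ D / 2`.
  refine ⟨min (min ε₁ (1 / κ)) (min (min 1 (R / 4 / (B + 1))) (D / (2 * (C + 1)))),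
    by positivity, fun ε hε hε2 X hX hX0 => ?_⟩
  simp only [lt_min_iff] at hε2
  obtain ⟨⟨hεε₁, hεκ⟩, ⟨hε1, hεB⟩, hεC⟩ := hε2
  have hεκ' : κ * ε ≤ 1 := by
    rw [lt_div_iff₀ hκ] at hεκ; linarith
  have hεB' : ε * B ≤ R / 4 := by
    rw [lt_div_iff₀ (by positivity)] at hεB; nlinarith
  have hεC' : ε * C ≤ D / 2 := by
    rw [lt_div_iff₀ (by positivity)] at hεC; nlinarith
  -- The extra `+ 1` is needed because the step from `k` uses the sum with index `k + 1`.
  have hlin : ∀ k : ℕ, k ≤ ⌊(N : ℝ) / ε⌋₊ + 1 → ε * (D / (2 * (N + 1)) * k + C) ≤ D := by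
    intro k hk
    have h1 : (k : ℝ) ≤ N / ε + 1 := by
      have h2 : (⌊(N : ℝ) / ε⌋₊ : ℝ) ≤ N / ε := Nat.floor_le (by positivity)
      have h3 : (k : ℝ) ≤ (⌊(N : ℝ) / ε⌋₊ : ℝ) + 1 := by exact_mod_cast hk
      linarith
    have h2 : ε * k ≤ N + 1 := by
      have h4 : ε * k ≤ ε * (N / ε + 1) := mul_le_mul_of_nonneg_left h1 hε.le
      have h5 : ε * (N / ε + 1) = N + ε := by field_simp
      linarith
    have h3 : ε * (D / (2 * (N + 1)) * k) ≤ D / 2 := by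
      have h4 : ε * (D / (2 * (N + 1)) * k) = D / (2 * (N + 1)) * (ε * k) := by ring
      have h5 : D / (2 * ((N : ℝ) + 1)) * (N + 1) = D / 2 := by field_simp
      rw [h4, ← h5]
      exact mul_le_mul_of_nonneg_left h2 (by positivity)
    linarith
  set S : ℕ → E → E := fun k x => ∑ i ∈ Finset.range k, (F i x - Φ x) with hSdef
  have hSb : ∀ k : ℕ, k ≤ ⌊(N : ℝ) / ε⌋₊ + 1 → ∀ x ∈ Metric.closedBall e R,
      ‖ε • S k x‖ ≤ D := by
    intro k hk x hx
    rw [norm_smul, Real.norm_of_nonneg hε.le]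
    exact (mul_le_mul_of_nonneg_left (hC k x hx).1 hε.le).trans (hlin k hk)
  have hSL : ∀ k : ℕ, k ≤ ⌊(N : ℝ) / ε⌋₊ + 1 → ∀ x ∈ Metric.closedBall e R,
      ∀ y ∈ Metric.closedBall e R, ‖ε • (S k y - S k x)‖ ≤ D * ‖y - x‖ := by
    intro k hk x hx y hy
    rw [norm_smul, Real.norm_of_nonneg hε.le]
    refine (mul_le_mul_of_nonneg_left ((hC k x hx).2 y hy) hε.le).trans ?_
    rw [← mul_assoc]
    exact mul_le_mul_of_nonneg_right (hlin k hk) (norm_nonneg _)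
  set b : ℝ := ‖T‖ * ((L + B) * D) with hb
  have hb0 : 0 ≤ b := by positivity
  have hq0 : 0 ≤ 1 - κ * ε := by linarith
  have hpow : ∀ k : ℕ, (1 - κ * ε) ^ k ≤ 1 := fun k => pow_le_one₀ hq0 (by nlinarith)
  -- bounds on the trajectory implied by a bound on the corrected trajectory
  have hZbound : ∀ k : ℕ,
      ‖T (X k - ε • S k (X k) - e)‖ ≤ (1 - κ * ε) ^ k * ‖T (X 0 - e)‖ + b / κ →
      ‖X k - ε • S k (X k) - e‖ ≤ ‖T‖ / m * ‖X 0 - e‖ * (1 - κ * ε) ^ k + b / κ / m := by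
    intro k hk
    have h1 := (hmT _).trans hk
    have h2 : (1 - κ * ε) ^ k * ‖T (X 0 - e)‖ ≤ (1 - κ * ε) ^ k * (‖T‖ * ‖X 0 - e‖) :=
      mul_le_mul_of_nonneg_left (T.le_opNorm _) (pow_nonneg hq0 _)
    have h3 : m * (‖T‖ / m * ‖X 0 - e‖ * (1 - κ * ε) ^ k + b / κ / m) =
        (1 - κ * ε) ^ k * (‖T‖ * ‖X 0 - e‖) + b / κ := by
      field_simp
    exact le_of_mul_le_mul_left (by linarith) hm
  have hsmall : ∀ k : ℕ, ‖T‖ / m * ‖X 0 - e‖ * (1 - κ * ε) ^ k ≤ R / 4 := by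
    intro k
    have h1 : 0 ≤ ‖T‖ / m * ‖X 0 - e‖ := by positivity
    have h2 : ‖T‖ / m * ‖X 0 - e‖ ≤ ‖T‖ / m * r :=
      mul_le_mul_of_nonneg_left hX0 (by positivity)
    nlinarith [mul_le_mul_of_nonneg_left (hpow k) h1]
  have hXZ : ∀ k : ℕ, k ≤ ⌊(N : ℝ) / ε⌋₊ + 1 → X k ∈ Metric.closedBall e R →
      ‖X k - e‖ ≤ ‖X k - ε • S k (X k) - e‖ + D := by
    intro k hk hx
    have h1 : X k - e = (X k - ε • S k (X k) - e) + ε • S k (X k) := by abel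
    calc ‖X k - e‖ = ‖(X k - ε • S k (X k) - e) + ε • S k (X k)‖ := by rw [← h1]
      _ ≤ _ := (norm_add_le _ _).trans (add_le_add le_rfl (hSb k hk _ hx))
  have hbκ : 0 ≤ b / κ / m := by positivity
  -- Bootstrap: from radius `R / 2` one step stays within `3R / 4`, where all bounds apply; the
  -- recursion then brings the new state back within `R / 4 + R / 4`.
  have key : ∀ k : ℕ, k ≤ ⌊(N : ℝ) / ε⌋₊ →
      ‖X k - e‖ ≤ R / 2 ∧
      ‖T (X k - ε • S k (X k) - e)‖ ≤ (1 - κ * ε) ^ k * ‖T (X 0 - e)‖ + b / κ := by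
    intro k
    induction k with
    | zero =>
      intro _
      refine ⟨by linarith, ?_⟩
      simp only [hSdef, Finset.range_zero, Finset.sum_empty, smul_zero, sub_zero, pow_zero, one_mul]
      have : 0 ≤ b / κ := by positivity
      linarith
    | succ k ih =>
      intro hk
      obtain ⟨h1, h2⟩ := ih (by omega)
      have hXk : X k ∈ Metric.closedBall e R := by
        rw [mem_closedBall_iff_norm]; linarith
      have hFB := hB k _ hXk
      have hXk1 : X (k + 1) ∈ Metric.closedBall e R := by
        rw [mem_closedBall_iff_norm, hX k]
        have h3 : ‖ε • F k (X k)‖ ≤ ε * B := by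
          rw [norm_smul, Real.norm_of_nonneg hε.le]
          exact mul_le_mul_of_nonneg_left hFB hε.le
        have h4 : X k + ε • F k (X k) - e = (X k - e) + ε • F k (X k) := by abel
        rw [h4]
        linarith [norm_add_le (X k - e) (ε • F k (X k))]
      have hZk : X k - ε • S k (X k) ∈ Metric.closedBall e R := by
        rw [mem_closedBall_iff_norm]
        have := hZbound k h2
        linarith [hsmall k]
      have hstep := corrected_step (T := T) (e := e) (Φ := Φ) (q := 1 - κ * ε) hε.le hD0.le
        (hX k) rfl rfl (S'X := S (k + 1) (X k)) (SX' := S (k + 1) (X (k + 1)))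
        (by simp only [hSdef, Finset.sum_range_succ]) (hT ε hε hεε₁ _ hZk)
        (hL _ hXk _ hZk) hL0 hFB (hSb k (by omega) _ hXk)
        (hSL (k + 1) (by omega) _ hXk _ hXk1)
      have h5 := le_pow_mul_add_of_recursion hκ hεκ' h2 hstep
      refine ⟨?_, h5⟩
      have h6 := hXZ (k + 1) (by omega) hXk1
      linarith [hZbound _ h5, hsmall (k + 1)]
  intro k hk
  obtain ⟨h1, h2⟩ := key k hk
  have h3 := hXZ k (by omega) (by rw [mem_closedBall_iff_norm]; linarith)
  linarith [hZbound k h2]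

/-! ### Moments of `sin v`, symmetry of the truncated noise, independence of the noise pairs -/

/-- Reflection invariance of the centred Gaussian; no integrability is required, as the Bochner
integral commutes with negation in any case. -/
theorem integral_gaussianReal_odd {σ : ℝ≥0} {φ : ℝ → ℝ} (hφ : ∀ y, φ (-y) = -φ y) :
    ∫ y, φ y ∂(gaussianReal 0 σ) = 0 := by
  have h1 : ∫ y, φ y ∂(gaussianReal 0 σ) = ∫ y, φ (-y) ∂(gaussianReal 0 σ) := by
    conv_lhs => rw [← neg_zero, ← gaussianReal_map_neg]
    exact integral_map_equiv (MeasurableEquiv.neg ℝ) φ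
  simp only [hφ, integral_neg] at h1
  linarith

/-- Real part of the Gaussian characteristic function. -/
theorem integral_gaussianReal_cos (σ : ℝ≥0) (t : ℝ) :
    ∫ y, Real.cos (t * y) ∂(gaussianReal 0 (σ ^ 2)) = Real.exp (-(σ : ℝ) ^ 2 * t ^ 2 / 2) := by
  have h := charFun_gaussianReal (μ := 0) (v := σ ^ 2) t
  rw [charFun_apply_real] at h
  have h2 := congrArg Complex.re h
  have hi : Integrable (fun y : ℝ => Complex.exp (t * y * Complex.I)) (gaussianReal 0 (σ ^ 2)) := by
    refine Integrable.of_bound (by fun_prop) 1 (Eventually.of_forall fun y => ?_)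
    rw [← Complex.ofReal_mul, Complex.norm_exp_ofReal_mul_I]
  rw [← Complex.reCLM_apply, ← Complex.reCLM.integral_comp_comm hi] at h2
  have h3 : ∀ y : ℝ, Complex.reCLM (Complex.exp (t * y * Complex.I)) = Real.cos (t * y) := by
    intro y
    rw [← Complex.ofReal_mul, Complex.reCLM_apply, Complex.exp_ofReal_mul_I_re]
  simp only [h3] at h2
  rw [h2]
  have h4 : (t * ((0 : ℝ) : ℂ) * Complex.I - (((σ ^ 2 : ℝ≥0) : ℝ) : ℂ) * (t : ℂ) ^ 2 / 2) =
      ((-(σ : ℝ) ^ 2 * t ^ 2 / 2 : ℝ) : ℂ) := by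
    push_cast
    ring
  rw [h4, Complex.exp_ofReal_re]

theorem integrable_cos_mul {μ : Measure ℝ} [IsProbabilityMeasure μ] (t : ℝ) :
    Integrable (fun y => Real.cos (t * y)) μ :=
  Integrable.of_bound (by fun_prop) 1 (Eventually.of_forall fun y => Real.abs_cos_le_one _)

theorem integral_gaussianReal_sin_sq (σ : ℝ≥0) :
    ∫ y, Real.sin y ^ 2 ∂(gaussianReal 0 (σ ^ 2)) = (1 - Real.exp (-2 * (σ : ℝ) ^ 2)) / 2 := by
  have h1 : ∀ y : ℝ, Real.sin y ^ 2 = (1 - Real.cos (2 * y)) / 2 := fun y => by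
    rw [Real.cos_two_mul, Real.cos_sq']; ring
  simp only [h1]
  rw [integral_div, integral_sub (integrable_const _) (integrable_cos_mul 2),
    integral_gaussianReal_cos]
  simp
  ring_nf

/-- Power reduction to `cos 2y` and `cos 4y`, whose means are `e^{-2σ²}` and `e^{-8σ²}`. -/
theorem integral_gaussianReal_sin_pow_four (σ : ℝ≥0) :
    ∫ y, Real.sin y ^ 4 ∂(gaussianReal 0 (σ ^ 2)) =
      (3 - 4 * Real.exp (-2 * (σ : ℝ) ^ 2) + Real.exp (-8 * (σ : ℝ) ^ 2)) / 8 := by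
  have h1 : ∀ y : ℝ, Real.sin y ^ 4 = (3 - 4 * Real.cos (2 * y) + Real.cos (4 * y)) / 8 := by
    intro y
    have h2 : Real.cos (4 * y) = 2 * Real.cos (2 * y) ^ 2 - 1 := by
      rw [← Real.cos_two_mul]; ring_nf
    have h3 : Real.sin y ^ 4 = (Real.sin y ^ 2) ^ 2 := by ring
    rw [h2, h3, Real.cos_two_mul, Real.sin_sq]; ring
  simp only [h1]
  have hi : Integrable (fun y : ℝ => 3 - 4 * Real.cos (2 * y)) (gaussianReal 0 (σ ^ 2)) :=
    (integrable_const _).sub ((integrable_cos_mul 2).const_mul 4)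
  rw [integral_div, integral_add hi (integrable_cos_mul 4), integral_sub (integrable_const _) ((integrable_cos_mul 2).const_mul 4),
    integral_const_mul, integral_gaussianReal_cos, integral_gaussianReal_cos]
  simp
  ring_nf

/-- This symmetry makes `W` centred. For `M < 0` the truncation would be the nonzero constant `-M`.
-/
theorem truncate_neg {M : ℝ} (hM : 0 ≤ M) (z : ℝ) : truncate M (-z) = -truncate M z := by
  unfold truncate
  rcases le_total z M with h1 | h1 <;> rcases le_total (-M) z with h2 | h2 <;>
    rcases le_total (-z) M with h3 | h3 <;> rcases le_total (-M) (-z) with h4 | h4 <;>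
    simp [*] <;> linarith

theorem abs_truncate_le {M : ℝ} (hM : 0 ≤ M) (z : ℝ) : |truncate M z| ≤ M := by
  unfold truncate
  rw [abs_le]
  exact ⟨le_max_left _ _, max_le (by linarith) (min_le_right _ _)⟩

theorem continuous_truncate (M : ℝ) : Continuous (truncate M) := by
  unfold truncate
  fun_prop

/-- Pairing two mutually independent sequences, each with independent entries, gives pairwise
independent pairs. -/
theorem indepFun_pair {Ω : Type*} [MeasurableSpace Ω] {P : Measure Ω} [IsProbabilityMeasure P]
    {v W : ℕ → Ω → ℝ} (hvm : ∀ k, Measurable (v k)) (hWm : ∀ k, Measurable (W k))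
    (hvW : IndepFun (fun ω k => v k ω) (fun ω k => W k ω) P) {i j : ℕ}
    (hv : IndepFun (v i) (v j) P) (hW : IndepFun (W i) (W j) P) :
    IndepFun (fun ω => (v i ω, W i ω)) (fun ω => (v j ω, W j ω)) P := by
  -- Independence of the two sequences separates the `v` events from the `W` events; independence
  -- within each sequence then splits both factors.
  have hrect : ∀ A B C D : Set ℝ, MeasurableSet A → MeasurableSet B → MeasurableSet C →
      MeasurableSet D → P ((v i ⁻¹' A ∩ v j ⁻¹' C) ∩ (W i ⁻¹' B ∩ W j ⁻¹' D)) =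
        (P (v i ⁻¹' A) * P (v j ⁻¹' C)) * (P (W i ⁻¹' B) * P (W j ⁻¹' D)) := by
    intro A B C D hA hB hC hD
    rw [← hv.measure_inter_preimage_eq_mul _ _ hA hC, ← hW.measure_inter_preimage_eq_mul _ _ hB hD]
    have h1 : MeasurableSet {x : ℕ → ℝ | x i ∈ A ∧ x j ∈ C} :=
      (measurable_pi_apply i hA).inter (measurable_pi_apply j hC)
    have h2 : MeasurableSet {x : ℕ → ℝ | x i ∈ B ∧ x j ∈ D} :=
      (measurable_pi_apply i hB).inter (measurable_pi_apply j hD)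
    exact hvW.measure_inter_preimage_eq_mul _ _ h1 h2
  have hm : ∀ k, Measurable fun ω => (v k ω, W k ω) := fun k => (hvm k).prodMk (hWm k)
  let π : ℕ → Set (Set Ω) := fun k =>
    {A | ∃ B ∈ Set.image2 (· ×ˢ ·) {A : Set ℝ | MeasurableSet A} {B : Set ℝ | MeasurableSet B},
      (fun ω => (v k ω, W k ω)) ⁻¹' B = A}
  have hπ : ∀ k, IsPiSystem (π k) := fun k => isPiSystem_prod.comap _
  have hgen : ∀ k, MeasurableSpace.comap (fun ω => (v k ω, W k ω)) inferInstance =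
      MeasurableSpace.generateFrom (π k) := by
    intro k
    rw [← generateFrom_prod, MeasurableSpace.comap_generateFrom]
    rfl
  refine (IndepFun_iff_Indep _ _ _).2
    (IndepSets.indep (hm i).comap_le (hm j).comap_le (hπ i) (hπ j) (hgen i) (hgen j) ?_)
  rw [IndepSets_iff]
  rintro _ _ ⟨_, ⟨A, hA, B, hB, rfl⟩, rfl⟩ ⟨_, ⟨C, hC, D, hD, rfl⟩, rfl⟩
  have e1 : ∀ (k : ℕ) (A B : Set ℝ),
      (fun ω => (v k ω, W k ω)) ⁻¹' (A ×ˢ B) = v k ⁻¹' A ∩ W k ⁻¹' B := fun _ _ _ => rfl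
  have h4 := hrect A B C D hA hB hC hD
  have h5 := hrect A B Set.univ Set.univ hA hB .univ .univ
  have h6 := hrect Set.univ Set.univ C D .univ .univ hC hD
  simp only [Set.preimage_univ, Set.univ_inter, Set.inter_univ, measure_univ, mul_one, one_mul]
    at h5 h6
  rw [e1, e1, Set.inter_inter_inter_comm, h4, h5, h6]
  ring

/-! ### Expansion in the amplitude and the root of the correlation -/

/-- Taylor's theorem with remainder of order `n + 1` near the origin. -/
theorem exists_taylor_bound {f : ℝ → ℝ} {n : ℕ} (hf : ContDiff ℝ (n + 1 : ℕ) f) :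
    ∃ ρ K : ℝ, 0 < ρ ∧ 0 ≤ K ∧ ∀ u, |u| ≤ ρ →
      |f u - ∑ k ∈ Finset.range (n + 1), iteratedDeriv k f 0 / k.factorial * u ^ k| ≤
        K * |u| ^ (n + 1) := by
  have h := (taylor_isLittleO_univ (x₀ := 0) hf).bound one_pos
  obtain ⟨ρ, hρ, hb⟩ := Metric.eventually_nhds_iff.1 h
  -- The expansion is taken one order further with a little-o remainder; `K` adds the size of its
  -- last coefficient to the little-o constant `1`.
  refine ⟨ρ / 2, 1 + |iteratedDeriv (n + 1) f 0 / (n + 1).factorial|, by positivity,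
    by positivity, fun u hu => ?_⟩
  have h1 := hb (y := u) (by rw [Real.dist_eq, sub_zero]; linarith)
  rw [taylor_within_apply, Finset.sum_range_succ] at h1
  simp only [sub_zero, iteratedDerivWithin_univ, smul_eq_mul, one_mul, Real.norm_eq_abs,
    abs_pow] at h1
  have h2 : ∀ k : ℕ, ((k.factorial : ℝ)⁻¹ * u ^ k) * iteratedDeriv k f 0 =
      iteratedDeriv k f 0 / k.factorial * u ^ k := fun k => by ring
  simp only [h2] at h1
  have h3 : |iteratedDeriv (n + 1) f 0 / (n + 1).factorial * u ^ (n + 1)| =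
      |iteratedDeriv (n + 1) f 0 / (n + 1).factorial| * |u| ^ (n + 1) := by
    rw [abs_mul, abs_pow]
  rw [abs_le] at h1 ⊢
  have h4 := abs_le.1 h3.le
  constructor <;> nlinarith [h1.1, h1.2, h4.1, h4.2]

theorem abs_integral_sub_le {Ω : Type*} [MeasurableSpace Ω] {P : Measure Ω}
    [IsProbabilityMeasure P] {φ ψ : Ω → ℝ} (hφ : Integrable φ P) (hψ : Integrable ψ P) {B : ℝ}
    (h : ∀ ω, |φ ω - ψ ω| ≤ B) : |∫ ω, φ ω ∂P - ∫ ω, ψ ω ∂P| ≤ B := by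
  rw [← integral_sub hφ hψ]
  simpa using norm_integral_le_of_norm_le_const (μ := P) (f := fun ω => φ ω - ψ ω)
    (Eventually.of_forall h)

section Expansion

variable {Ω : Type*} [MeasurableSpace Ω] {P : Measure Ω} [IsProbabilityMeasure P] {s : Ω → ℝ}

theorem integrable_comp_of_abs_le_one (hs : Measurable s) (hs1 : ∀ ω, |s ω| ≤ 1) {φ : ℝ → ℝ}
    (hφ : Continuous φ) : Integrable (fun ω => φ (s ω)) P := by
  obtain ⟨B, hB⟩ := (isCompact_Icc.image hφ : IsCompact (φ '' Set.Icc (-1) 1)).isBounded.exists_norm_le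
  exact Integrable.of_bound (hφ.measurable.comp hs).aestronglyMeasurable B
    (Eventually.of_forall fun ω => hB _ ⟨_, abs_le.1 (hs1 ω), rfl⟩)

/-- The weight `q` covers both uses: `q y = y` for the correlation, `q = 1` for the mean. -/
theorem hasDerivAt_expectation_comp (hs : Measurable s) (hs1 : ∀ ω, |s ω| ≤ 1) {f : ℝ → ℝ}
    (hf : ContDiff ℝ 1 f) {q : ℝ → ℝ} (hq : Continuous q) (a θ : ℝ) :
    HasDerivAt (fun θ => ∫ ω, f (θ + a * s ω) * q (s ω) ∂P)
      (∫ ω, deriv f (θ + a * s ω) * q (s ω) ∂P) θ := by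
  have hfc := hf.continuous
  have hfd : Continuous (deriv f) := hf.continuous_deriv le_rfl
  have h := hasFDerivAt_expectation (P := P) (g := fun θ y : ℝ => f (θ + a * y) * q y)
    (g' := fun θ y : ℝ => ContinuousLinearMap.toSpanSingleton ℝ (deriv f (θ + a * y) * q y))
    (by unfold Function.uncurry; fun_prop)
    (by
      unfold Function.uncurry
      exact (ContinuousLinearMap.toSpanSingletonCLE (𝕜 := ℝ) (E := ℝ)).continuous.comp
        (by fun_prop))
    (fun x y => by
      have h1 : HasDerivAt (fun x => x + a * y) 1 x := (hasDerivAt_id x).add_const _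
      have h2 := ((hf.differentiable (by simp) (x + a * y)).hasDerivAt.comp x h1).mul_const (q y)
      simp only [mul_one] at h2
      exact h2.hasFDerivAt)
    hs (isCompact_Icc (a := (-1 : ℝ)) (b := 1)) (fun ω => abs_le.1 (hs1 ω)) θ
  have h2 := h.hasDerivAt
  rw [ContinuousLinearMap.integral_apply] at h2
  · simpa using h2
  · exact (ContinuousLinearMap.toSpanSingletonCLE (𝕜 := ℝ)
      (E := ℝ)).toContinuousLinearMap.integrable_comp
        (φ := fun ω => deriv f (θ + a * s ω) * q (s ω))
        (integrable_comp_of_abs_le_one hs hs1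
          (by fun_prop : Continuous fun y => deriv f (θ + a * y) * q y))

/-- Odd moments vanish. The Taylor polynomials below, with weight `s` or `1`, are all quartics in
`s`. -/
theorem integral_quartic (hs : Measurable s) (hs1 : ∀ ω, |s ω| ≤ 1) {m₂ m₄ : ℝ}
    (h1 : ∫ ω, s ω ∂P = 0) (h2 : ∫ ω, s ω ^ 2 ∂P = m₂) (h3 : ∫ ω, s ω ^ 3 ∂P = 0)
    (h4 : ∫ ω, s ω ^ 4 ∂P = m₄) (c₀ c₁ c₂ c₃ c₄ : ℝ) :
    ∫ ω, (c₀ + c₁ * s ω + c₂ * s ω ^ 2 + c₃ * s ω ^ 3 + c₄ * s ω ^ 4) ∂P =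
      c₀ + c₂ * m₂ + c₄ * m₄ := by
  have hint : ∀ {φ : ℝ → ℝ}, Continuous φ → Integrable (fun ω => φ (s ω)) P := fun hφ =>
    integrable_comp_of_abs_le_one hs hs1 hφ
  rw [integral_add
      (hint (by fun_prop : Continuous fun y => c₀ + c₁ * y + c₂ * y ^ 2 + c₃ * y ^ 3))
      (hint (by fun_prop : Continuous fun y => c₄ * y ^ 4)),
    integral_add (hint (by fun_prop : Continuous fun y => c₀ + c₁ * y + c₂ * y ^ 2))
      (hint (by fun_prop : Continuous fun y => c₃ * y ^ 3)),
    integral_add (hint (by fun_prop : Continuous fun y => c₀ + c₁ * y))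
      (hint (by fun_prop : Continuous fun y => c₂ * y ^ 2)),
    integral_add (integrable_const _) (hint (by fun_prop : Continuous fun y => c₁ * y)),
    integral_const_mul, integral_const_mul, integral_const_mul, integral_const_mul, h1, h2, h3, h4]
  simp

theorem abs_add_mul_le {θ a y : ℝ} (ha : 0 ≤ a) (hθ : |θ| ≤ a) (hy : |y| ≤ 1) :
    |θ + a * y| ≤ 2 * a := by
  refine (abs_add_le _ _).trans ?_
  rw [abs_mul, abs_of_nonneg ha]
  nlinarith

/-- Replacing `f` by an approximation `p` in the correlation `E[f(θ + a s) q(s)]`. -/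
theorem abs_expectation_sub_le {s : Ω → ℝ} (hs : Measurable s) (hs1 : ∀ ω, |s ω| ≤ 1)
    {f p q : ℝ → ℝ} (hf : Continuous f) (hp : Continuous p) (hq : Continuous q)
    (hq1 : ∀ y, |y| ≤ 1 → |q y| ≤ 1) {ρ K : ℝ} {n : ℕ} (hK : 0 ≤ K)
    (hfp : ∀ u, |u| ≤ ρ → |f u - p u| ≤ K * |u| ^ n) {a θ : ℝ} (ha : 0 ≤ a) (hθ : |θ| ≤ a)
    (haρ : 2 * a ≤ ρ) :
    |∫ ω, f (θ + a * s ω) * q (s ω) ∂P - ∫ ω, p (θ + a * s ω) * q (s ω) ∂P| ≤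
      K * (2 * a) ^ n := by
  refine abs_integral_sub_le
    (integrable_comp_of_abs_le_one hs hs1
      (by fun_prop : Continuous fun y => f (θ + a * y) * q y))
    (integrable_comp_of_abs_le_one hs hs1
      (by fun_prop : Continuous fun y => p (θ + a * y) * q y)) fun ω => ?_
  have hu := abs_add_mul_le ha hθ (hs1 ω)
  rw [← sub_mul, abs_mul]
  have h1 := hfp _ (hu.trans haρ)
  have h2 : K * |θ + a * s ω| ^ n ≤ K * (2 * a) ^ n :=
    mul_le_mul_of_nonneg_left (pow_le_pow_left₀ (abs_nonneg _) hu n) hK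
  have h3 := mul_le_mul_of_nonneg_left (hq1 _ (hs1 ω)) (abs_nonneg (f (θ + a * s ω) - p (θ + a * s ω)))
  linarith

end Expansion

/-- Expansions in the amplitude `a` of the correlation, of the mean and of the derivative of the
correlation of `ς(θ + a s)`, uniformly in `|θ| ≤ a`. -/
theorem exists_correlation_bounds {Ω : Type*} [MeasurableSpace Ω] {P : Measure Ω}
    [IsProbabilityMeasure P] {s : Ω → ℝ} (hs : Measurable s) (hs1 : ∀ ω, |s ω| ≤ 1)
    {m₂ m₄ : ℝ} (h1 : ∫ ω, s ω ∂P = 0) (h2 : ∫ ω, s ω ^ 2 ∂P = m₂) (h3 : ∫ ω, s ω ^ 3 ∂P = 0)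
    (h4 : ∫ ω, s ω ^ 4 ∂P = m₄)
    {ς : ℝ → ℝ} (hς : ContDiff ℝ 4 ς) (hς0 : ς 0 = 0) (hς1 : deriv ς 0 = 0)
    {b₂ b₃ : ℝ} (hb₂ : iteratedDeriv 2 ς 0 = b₂) (hb₃ : iteratedDeriv 3 ς 0 = b₃) :
    ∃ ρ K₁ K₂ K₃ : ℝ, 0 < ρ ∧ 0 ≤ K₁ ∧ 0 ≤ K₂ ∧ 0 ≤ K₃ ∧
    (∀ a θ : ℝ, 0 ≤ a → |θ| ≤ a → 2 * a ≤ ρ →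
      |∫ ω, ς (θ + a * s ω) * s ω ∂P - (b₂ * m₂ * (a * θ) + b₃ / 6 * (3 * θ ^ 2 * a * m₂ + a ^ 3 * m₄))|
        ≤ K₃ * (2 * a) ^ 4) ∧
    (∀ a θ : ℝ, 0 ≤ a → |θ| ≤ a → 2 * a ≤ ρ →
      |∫ ω, ς (θ + a * s ω) ∂P - b₂ / 2 * (θ ^ 2 + a ^ 2 * m₂)| ≤ K₂ * (2 * a) ^ 3) ∧
    (∀ a θ : ℝ, 0 ≤ a → |θ| ≤ a → 2 * a ≤ ρ →
      |∫ ω, deriv ς (θ + a * s ω) * s ω ∂P - b₂ * m₂ * a| ≤ K₁ * (2 * a) ^ 2) := by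
  have hςc := hς.continuous
  obtain ⟨ρ₃, K₃, hρ₃, hK₃, hT₃⟩ := exists_taylor_bound (f := ς) (n := 3) hς
  obtain ⟨ρ₂, K₂, hρ₂, hK₂, hT₂⟩ := exists_taylor_bound (f := ς) (n := 2)
    (hς.of_le (by norm_num))
  obtain ⟨ρ₁, K₁, hρ₁, hK₁, hT₁⟩ := exists_taylor_bound (f := deriv ς) (n := 1)
    ((hς.of_le (by norm_num : (3 : WithTop ℕ∞) ≤ 4)).deriv' (n := 2))
  have hb₂' : deriv (deriv ς) 0 = b₂ := by
    rw [← hb₂, iteratedDeriv_succ, iteratedDeriv_one]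
  simp only [Finset.sum_range_succ, Finset.sum_range_zero, iteratedDeriv_zero, iteratedDeriv_one,
    hς0, hς1, hb₂, hb₃, hb₂', Nat.factorial] at hT₁ hT₂ hT₃
  have hpoly := integral_quartic (P := P) hs hs1 h1 h2 h3 h4
  set ρ := min ρ₃ (min ρ₂ ρ₁) with hρdef
  have hρ : 0 < ρ := by positivity
  refine ⟨ρ, K₁, K₂, K₃, hρ, hK₁, hK₂, hK₃, ?_, ?_, ?_⟩
  · intro a θ ha hθ haρ
    have h := abs_expectation_sub_le (P := P) hs hs1 hςc
      (p := fun u => b₂ / 2 * u ^ 2 + b₃ / 6 * u ^ 3) (q := fun y => y) (by fun_prop) (by fun_prop)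
      (fun y hy => hy) (ρ := ρ) (n := 4) hK₃
      (fun u hu => by
        have := hT₃ u (hu.trans (min_le_left _ _))
        norm_num at this
        exact this) ha hθ haρ
    have e : ∫ ω, (b₂ / 2 * (θ + a * s ω) ^ 2 + b₃ / 6 * (θ + a * s ω) ^ 3) * s ω ∂P =
        b₂ * m₂ * (a * θ) + b₃ / 6 * (3 * θ ^ 2 * a * m₂ + a ^ 3 * m₄) := by
      have e1 := hpoly 0 (b₂ / 2 * θ ^ 2 + b₃ / 6 * θ ^ 3)
        (b₂ * a * θ + b₃ / 6 * (3 * θ ^ 2 * a)) (b₂ / 2 * a ^ 2 + b₃ / 6 * (3 * θ * a ^ 2))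
        (b₃ / 6 * a ^ 3)
      calc _ = _ := by congr 1; ext ω; ring
        _ = _ := e1
        _ = _ := by ring
    rw [e] at h
    exact h
  · intro a θ ha hθ haρ
    have h := abs_expectation_sub_le (P := P) hs hs1 hςc
      (p := fun u => b₂ / 2 * u ^ 2) (q := fun _ => 1) (by fun_prop) (by fun_prop)
      (fun y hy => by simp) (ρ := ρ) (n := 3) hK₂
      (fun u hu => by
        have := hT₂ u (hu.trans ((min_le_right _ _).trans (min_le_left _ _)))
        norm_num at this
        exact this) ha hθ haρ
    simp only [mul_one] at h
    have e : ∫ ω, (b₂ / 2 * (θ + a * s ω) ^ 2) ∂P = b₂ / 2 * (θ ^ 2 + a ^ 2 * m₂) := by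
      have e1 := hpoly (b₂ / 2 * θ ^ 2) (b₂ * a * θ) (b₂ / 2 * a ^ 2) 0 0
      calc _ = _ := by congr 1; ext ω; ring
        _ = _ := e1
        _ = _ := by ring
    rw [e] at h
    exact h
  · intro a θ ha hθ haρ
    have h := abs_expectation_sub_le (P := P) hs hs1 (hς.continuous_deriv (by norm_num))
      (p := fun u => b₂ * u) (q := fun y => y) (by fun_prop) (by fun_prop)
      (fun y hy => hy) (ρ := ρ) (n := 2) hK₁
      (fun u hu => by
        have := hT₁ u (hu.trans ((min_le_right _ _).trans (min_le_right _ _)))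
        norm_num at this
        rw [sq_abs]
        exact this) ha hθ haρ
    have e : ∫ ω, b₂ * (θ + a * s ω) * s ω ∂P = b₂ * m₂ * a := by
      have e1 := hpoly 0 (b₂ * θ) (b₂ * a) 0 0
      calc _ = _ := by congr 1; ext ω; ring
        _ = _ := e1
        _ = _ := by ring
    rw [e] at h
    exact h

/-- Existence and asymptotic expansion of the zero of `θ ↦ E[ς(θ + a s) s]` near a strict local
maximum, for a bounded noise `s` with vanishing first and third moments. -/
theorem exists_zero_expansion {Ω : Type*} [MeasurableSpace Ω] {P : Measure Ω}
    [IsProbabilityMeasure P] {s : Ω → ℝ} (hs : Measurable s) (hs1 : ∀ ω, |s ω| ≤ 1)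
    {m₂ m₄ : ℝ} (h1 : ∫ ω, s ω ∂P = 0) (h2 : ∫ ω, s ω ^ 2 ∂P = m₂) (h3 : ∫ ω, s ω ^ 3 ∂P = 0)
    (h4 : ∫ ω, s ω ^ 4 ∂P = m₄) (hm₂ : 0 < m₂)
    {ς : ℝ → ℝ} (hς : ContDiff ℝ 4 ς) (hς0 : ς 0 = 0) (hς1 : deriv ς 0 = 0)
    {b₂ b₃ : ℝ} (hb₂ : iteratedDeriv 2 ς 0 = b₂) (hb₃ : iteratedDeriv 3 ς 0 = b₃) (hneg : b₂ < 0) :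
    ∃ aStar : ℝ, 0 < aStar ∧ ∃ θe : ℝ → ℝ,
      (fun a : ℝ => θe a - -(b₃ * m₄) / (6 * b₂ * m₂) * a ^ 2) =O[𝓝[>] 0] (fun a : ℝ => a ^ 3) ∧
      (fun a : ℝ => ∫ ω, ς (θe a + a * s ω) ∂P - b₂ * m₂ / 2 * a ^ 2)
        =O[𝓝[>] 0] (fun a : ℝ => a ^ 3) ∧
      ∀ a : ℝ, 0 < a → a < aStar →
        ∫ ω, ς (θe a + a * s ω) * s ω ∂P = 0 ∧
        ∫ ω, deriv ς (θe a + a * s ω) * s ω ∂P < 0 := by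
  obtain ⟨ρ, K₁, K₂, K₃, hρ, hK₁, hK₂, hK₃, hcorr, hmean, hder⟩ :=
    exists_correlation_bounds hs hs1 h1 h2 h3 h4 hς hς0 hς1 hb₂ hb₃
  have hb₂0 : b₂ ≠ 0 := hneg.ne
  -- The value of `θ / a²` that cancels the `a³` terms of the correlation.
  set c : ℝ := -(b₃ * m₄) / (6 * b₂ * m₂) with hc
  have hcb : b₂ * m₂ * c + b₃ / 6 * m₄ = 0 := by
    rw [hc]; field_simp; ring
  set c₁ : ℝ := |c| + 1 with hc₁
  have hc₁0 : 0 < c₁ := by positivity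
  -- `A a⁴` bounds the error of the correlation: the first part is the `θ² a` term with `|θ| ≤ c₁
  -- a²`, and `16 K₃` is the Taylor remainder. `C` makes the main term `b₂ m₂ t a⁴` equal to `∓(A +
  -- 1) a⁴` at `t = ±C`.
  set A : ℝ := |b₃| / 2 * c₁ ^ 2 * m₂ + 16 * K₃ with hA
  have hA0 : 0 ≤ A := by positivity
  set C : ℝ := (A + 1) / (-b₂ * m₂) with hC
  have hbm : 0 < -b₂ * m₂ := mul_pos (by linarith) hm₂
  have hC0 : 0 < C := by positivity
  have hCb : b₂ * m₂ * C = -(A + 1) := by rw [hC]; field_simp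
  obtain ⟨aS, haS0, haS⟩ : ∃ aS : ℝ, 0 < aS ∧ ∀ a, a < aS →
      a < 1 ∧ a * c₁ < 1 ∧ a * C < 1 ∧ a < ρ / 2 ∧ a * (4 * K₁ + 1) < -b₂ * m₂ := by
    refine ⟨min (min 1 (1 / c₁)) (min (min (1 / C) (ρ / 2)) (-b₂ * m₂ / (4 * K₁ + 1))),
      by positivity, fun a ha => ?_⟩
    simp only [lt_min_iff] at ha
    obtain ⟨⟨ha1, ha2⟩, ⟨ha3, ha4⟩, ha5⟩ := ha
    exact ⟨ha1, (lt_div_iff₀ hc₁0).1 ha2, (lt_div_iff₀ hC0).1 ha3, ha4,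
      (lt_div_iff₀ (by positivity)).1 ha5⟩
  have hθb : ∀ a t : ℝ, 0 < a → a < aS → |t| ≤ C →
      |c * a ^ 2 + t * a ^ 3| ≤ c₁ * a ^ 2 ∧ |c * a ^ 2 + t * a ^ 3| ≤ a := by
    intro a t ha haa ht
    obtain ⟨ha1, hac, haC, _⟩ := haS a haa
    have h5 : |c * a ^ 2 + t * a ^ 3| ≤ |c| * a ^ 2 + |t| * a ^ 3 := by
      refine (abs_add_le _ _).trans (le_of_eq ?_)
      rw [abs_mul, abs_mul, abs_of_pos (pow_pos ha 2), abs_of_pos (pow_pos ha 3)]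
    have h6 : |t| * a ^ 3 ≤ 1 * a ^ 2 := by
      have : |t| * a ≤ 1 := by nlinarith
      have h7 : |t| * a ^ 3 = (|t| * a) * a ^ 2 := by ring
      rw [h7]
      exact mul_le_mul_of_nonneg_right this (by positivity)
    have h8 : |c * a ^ 2 + t * a ^ 3| ≤ c₁ * a ^ 2 := by rw [hc₁]; linarith
    refine ⟨h8, h8.trans ?_⟩
    nlinarith
  -- Rescaled unknown `t` in `θ = c a² + t a³`: the correlation is `b₂ m₂ t a⁴` up to `A a⁴`, so it
  -- changes sign on `[-C, C]`, and a bounded `t` is exactly the `O(a³)` claim.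
  have hex : ∀ a : ℝ, 0 < a → a < aS → ∃ t : ℝ, |t| ≤ C ∧
      ∫ ω, ς (c * a ^ 2 + t * a ^ 3 + a * s ω) * s ω ∂P = 0 := by
    intro a ha haa
    obtain ⟨ha1, _, _, haρ, _⟩ := haS a haa
    set g : ℝ → ℝ := fun t => ∫ ω, ς (c * a ^ 2 + t * a ^ 3 + a * s ω) * s ω ∂P with hg
    have hgc : Continuous g := by
      have hcont : Continuous fun θ => ∫ ω, ς (θ + a * s ω) * s ω ∂P :=
        continuous_iff_continuousAt.2 fun θ =>
          (hasDerivAt_expectation_comp (P := P) hs hs1 (hς.of_le (by norm_num)) (q := fun y => y)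
            continuous_id a θ).continuousAt
      exact hcont.comp (by fun_prop : Continuous fun t : ℝ => c * a ^ 2 + t * a ^ 3)
    have hgb : ∀ t, |t| ≤ C → |g t - b₂ * m₂ * t * a ^ 4| ≤ A * a ^ 4 := by
      intro t ht
      obtain ⟨h5, h6⟩ := hθb a t ha haa ht
      have h7 := hcorr a _ ha.le h6 (by linarith)
      set θ := c * a ^ 2 + t * a ^ 3 with hθ
      have h8 : b₂ * m₂ * (a * θ) + b₃ / 6 * (3 * θ ^ 2 * a * m₂ + a ^ 3 * m₄) =
          b₂ * m₂ * t * a ^ 4 + b₃ / 2 * θ ^ 2 * a * m₂ := by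
        have : b₂ * m₂ * (a * θ) = (b₂ * m₂ * c) * a ^ 3 + b₂ * m₂ * t * a ^ 4 := by rw [hθ]; ring
        rw [this, eq_neg_of_add_eq_zero_left hcb]
        ring
      have h9 : θ ^ 2 * a ≤ c₁ ^ 2 * a ^ 4 := by
        have h10 : θ ^ 2 ≤ (c₁ * a ^ 2) ^ 2 := by
          rw [← sq_abs θ]; exact pow_le_pow_left₀ (abs_nonneg _) h5 2
        have h11 : θ ^ 2 * a ≤ θ ^ 2 * 1 := mul_le_mul_of_nonneg_left ha1.le (sq_nonneg _)
        calc θ ^ 2 * a ≤ (c₁ * a ^ 2) ^ 2 := by linarith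
          _ = _ := by ring
      have h12 : |b₃ / 2 * θ ^ 2 * a * m₂| ≤ |b₃| / 2 * c₁ ^ 2 * m₂ * a ^ 4 := by
        have h13 : b₃ / 2 * θ ^ 2 * a * m₂ = b₃ * (m₂ / 2 * (θ ^ 2 * a)) := by ring
        rw [h13, abs_mul, abs_of_nonneg (by positivity : 0 ≤ m₂ / 2 * (θ ^ 2 * a))]
        have h14 := mul_le_mul_of_nonneg_left
          (mul_le_mul_of_nonneg_left h9 (by positivity : 0 ≤ m₂ / 2)) (abs_nonneg b₃)
        linarith
      rw [h8] at h7
      have h15 : g t - b₂ * m₂ * t * a ^ 4 = (g t - (b₂ * m₂ * t * a ^ 4 + b₃ / 2 * θ ^ 2 * a * m₂)) +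
          b₃ / 2 * θ ^ 2 * a * m₂ := by ring
      rw [h15]
      refine (abs_add_le _ _).trans ((add_le_add h7 h12).trans (le_of_eq ?_))
      rw [hA]; ring
    have ha4 : 0 < a ^ 4 := by positivity
    have hgp : g C ≤ 0 := by
      have h5 := (abs_le.1 (hgb C (abs_of_pos hC0).le)).2
      rw [hCb] at h5
      linarith
    have hgm : 0 ≤ g (-C) := by
      have h5 := (abs_le.1 (hgb (-C) (by rw [abs_neg]; exact (abs_of_pos hC0).le))).1
      have h6 : b₂ * m₂ * -C = A + 1 := by linarith
      rw [h6] at h5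
      linarith
    obtain ⟨t, ht, hgt⟩ := intermediate_value_Icc' (by linarith : -C ≤ C) hgc.continuousOn
      (⟨hgp, hgm⟩ : (0 : ℝ) ∈ Set.Icc (g C) (g (-C)))
    exact ⟨t, abs_le.2 ht, hgt⟩
  choose! t ht htz using hex
  have hev : ∀ᶠ a in 𝓝[>] (0 : ℝ), 0 < a ∧ a < aS :=
    (eventually_mem_nhdsWithin).and (eventually_nhdsWithin_of_eventually_nhds
      (eventually_lt_nhds haS0))
  refine ⟨aS, haS0, fun a => c * a ^ 2 + t a * a ^ 3, ?_, ?_, fun a ha haa => ⟨htz a ha haa, ?_⟩⟩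
  · refine IsBigO.of_bound C ?_
    filter_upwards [hev] with a ⟨ha, haa⟩
    rw [add_sub_cancel_left, norm_mul]
    exact mul_le_mul_of_nonneg_right (ht a ha haa) (norm_nonneg _)
  · refine IsBigO.of_bound (8 * K₂ + -b₂ / 2 * c₁ ^ 2) ?_
    filter_upwards [hev] with a ⟨ha, haa⟩
    obtain ⟨ha1, _, _, haρ, _⟩ := haS a haa
    obtain ⟨h5, h6⟩ := hθb a _ ha haa (ht a ha haa)
    have h7 := hmean a _ ha.le h6 (by linarith)
    set θ := c * a ^ 2 + t a * a ^ 3 with hθ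
    have h9 : θ ^ 2 ≤ c₁ ^ 2 * a ^ 3 := by
      have h10 : θ ^ 2 ≤ (c₁ * a ^ 2) ^ 2 := by
        rw [← sq_abs θ]; exact pow_le_pow_left₀ (abs_nonneg _) h5 2
      calc θ ^ 2 ≤ c₁ ^ 2 * a ^ 3 * a := h10.trans (le_of_eq (by ring))
        _ ≤ c₁ ^ 2 * a ^ 3 * 1 := mul_le_mul_of_nonneg_left ha1.le (by positivity)
        _ = _ := mul_one _
    rw [Real.norm_eq_abs, Real.norm_eq_abs, abs_of_pos (pow_pos ha 3)]
    rw [abs_le] at h7 ⊢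
    have h12 := mul_le_mul_of_nonneg_left h9 (by linarith : 0 ≤ -b₂ / 2)
    have h13 : 0 ≤ -b₂ / 2 * θ ^ 2 := mul_nonneg (by linarith) (sq_nonneg _)
    have h14 : K₂ * (2 * a) ^ 3 = 8 * K₂ * a ^ 3 := by ring
    have h15 : b₂ / 2 * (θ ^ 2 + a ^ 2 * m₂) = b₂ * m₂ / 2 * a ^ 2 - -b₂ / 2 * θ ^ 2 := by ring
    have h16 : 0 ≤ -b₂ / 2 * (c₁ ^ 2 * a ^ 3) := h13.trans h12
    rw [h14, h15] at h7
    rw [add_mul, mul_assoc (-b₂ / 2)]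
    constructor <;> linarith [h7.1, h7.2]
  · obtain ⟨ha1, _, _, haρ, haK⟩ := haS a haa
    obtain ⟨h5, h6⟩ := hθb a _ ha haa (ht a ha haa)
    have h7 := (abs_le.1 (hder a _ ha.le h6 (by linarith))).2
    have h8 : a * (a * (4 * K₁ + 1)) < a * (-b₂ * m₂) := mul_lt_mul_of_pos_left haK ha
    have h9 : 0 < a * a := mul_pos ha ha
    linarith

/-! ### Lyapunov contraction and almost sure stability -/

/-- A field with a zero at `e` whose linearization is dissipative for the inner product
`⟪T x, T y⟫` gives, after one Euler step, a contraction near `e` for the norm `‖T ·‖`. -/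
theorem exists_euler_contraction {E H : Type*} [NormedAddCommGroup E] [NormedSpace ℝ E]
    [NormedAddCommGroup H] [InnerProductSpace ℝ H] {T : E →L[ℝ] H} {e : E} {Φ : E → E}
    {J : E →L[ℝ] E} (hJ : HasFDerivAt Φ J e) (he : Φ e = 0) {m lam : ℝ} (hm : 0 < m)
    (hmT : ∀ x, m * ‖x‖ ≤ ‖T x‖) (hlam : 0 < lam)
    (hdiss : ∀ x, inner ℝ (T x) (T (J x)) ≤ -lam * ‖T x‖ ^ 2) :
    ∃ R κ ε₁ : ℝ, 0 < R ∧ 0 < κ ∧ 0 < ε₁ ∧ ∀ ε, 0 < ε → ε < ε₁ →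
      ∀ x ∈ Metric.closedBall e R, ‖T (x - e + ε • Φ x)‖ ≤ (1 - κ * ε) * ‖T (x - e)‖ := by
  -- This linearization tolerance costs at most `lam / 2 * ‖y‖` after applying `T`, half of the
  -- dissipation.
  have hc : 0 < lam * m / (2 * (‖T‖ + 1)) := by positivity
  obtain ⟨R, hR, hb⟩ := Metric.eventually_nhds_iff.1 (hJ.isLittleO.bound hc)
  set L : ℝ := ‖T‖ * ‖J‖ / m + lam / 2 with hL
  have hL0 : 0 ≤ L := by positivity
  -- The inner-product term contributes `-ε lam ‖y‖²`. The bound `ε L² ≤ lam / 2` limits the square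
  -- of the step to half of that, leaving `1 - ε lam / 2 ≤ (1 - ε lam / 4)²`.
  refine ⟨R / 2, lam / 4, min (lam / (2 * (L ^ 2 + 1))) (4 / lam), by positivity, by positivity,
    by positivity, fun ε hε hε1 x hx => ?_⟩
  rw [lt_min_iff, lt_div_iff₀ (by positivity), lt_div_iff₀ hlam] at hε1
  have h1 := hb (y := x) (lt_of_le_of_lt hx (by linarith))
  rw [he, sub_zero] at h1
  set y := T (x - e) with hy
  have hrem : ‖T (Φ x - J (x - e))‖ ≤ lam / 2 * ‖y‖ := by
    have h2 := (T.le_opNorm _).trans (mul_le_mul_of_nonneg_left h1 (norm_nonneg T))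
    have h3 : ‖T‖ * (lam * m / (2 * (‖T‖ + 1)) * ‖x - e‖) =
        ‖T‖ / (‖T‖ + 1) * (lam / 2 * (m * ‖x - e‖)) := by
      field_simp
    have h4 : ‖T‖ / (‖T‖ + 1) ≤ 1 := by
      rw [div_le_one (by positivity)]; linarith
    have h5 : lam / 2 * (m * ‖x - e‖) ≤ lam / 2 * ‖y‖ :=
      mul_le_mul_of_nonneg_left (hmT _) (by positivity)
    rw [h3] at h2
    refine h2.trans (le_trans ?_ h5)
    have h6 : 0 ≤ lam / 2 * (m * ‖x - e‖) := by positivity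
    nlinarith
  have hsplit : T (Φ x) = T (J (x - e)) + T (Φ x - J (x - e)) := by
    rw [← map_add, add_sub_cancel]
  have hinner : inner ℝ y (T (Φ x)) ≤ -(lam / 2) * ‖y‖ ^ 2 := by
    rw [hsplit, inner_add_right]
    have h2 := hdiss (x - e)
    have h3 := (real_inner_le_norm y (T (Φ x - J (x - e)))).trans
      (mul_le_mul_of_nonneg_left hrem (norm_nonneg y))
    rw [← hy] at h2
    linarith
  have hnorm : ‖T (Φ x)‖ ≤ L * ‖y‖ := by
    rw [hsplit]
    refine (norm_add_le _ _).trans ?_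
    have h2 : ‖T (J (x - e))‖ ≤ ‖T‖ * ‖J‖ / m * ‖y‖ := by
      refine (T.le_opNorm _).trans ?_
      have h3 : ‖T‖ * ‖J (x - e)‖ ≤ ‖T‖ * (‖J‖ * ‖x - e‖) :=
        mul_le_mul_of_nonneg_left (J.le_opNorm _) (norm_nonneg _)
      have h4 : ‖T‖ * (‖J‖ * ‖x - e‖) = ‖T‖ * ‖J‖ / m * (m * ‖x - e‖) := by
        field_simp
      rw [h4] at h3
      exact h3.trans (mul_le_mul_of_nonneg_left (hmT _) (by positivity))
    rw [hL, add_mul]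
    exact add_le_add h2 hrem
  have hq : 0 ≤ 1 - lam / 4 * ε := by linarith
  have hsq : ‖T (x - e + ε • Φ x)‖ ^ 2 ≤ ((1 - lam / 4 * ε) * ‖y‖) ^ 2 := by
    rw [map_add, map_smul, norm_add_sq_real, inner_smul_right, norm_smul, Real.norm_of_nonneg hε.le]
    have h2 : ‖T (Φ x)‖ ^ 2 ≤ L ^ 2 * ‖y‖ ^ 2 := by
      rw [← mul_pow]; exact pow_le_pow_left₀ (norm_nonneg _) hnorm 2
    have h3 : (ε * ‖T (Φ x)‖) ^ 2 ≤ ε * (lam / 2) * ‖y‖ ^ 2 := by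
      have h4 : ε * L ^ 2 ≤ lam / 2 := by nlinarith
      calc (ε * ‖T (Φ x)‖) ^ 2 = ε * ε * ‖T (Φ x)‖ ^ 2 := by ring
        _ ≤ ε * ε * (L ^ 2 * ‖y‖ ^ 2) := mul_le_mul_of_nonneg_left h2 (by positivity)
        _ = ε * (ε * L ^ 2) * ‖y‖ ^ 2 := by ring
        _ ≤ _ := by gcongr
    have h5 := mul_le_mul_of_nonneg_left hinner hε.le
    have h6 : 0 ≤ (lam / 4 * ε) ^ 2 * ‖y‖ ^ 2 := by positivity
    have h7 : ((1 - lam / 4 * ε) * ‖y‖) ^ 2 =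
        ‖y‖ ^ 2 - ε * (lam / 2) * ‖y‖ ^ 2 + (lam / 4 * ε) ^ 2 * ‖y‖ ^ 2 := by ring
    rw [h7]
    linarith
  exact le_of_sq_le_sq hsq (by positivity)

/-- Almost sure weak exponential stability of an equilibrium of the average field, for the
recursion `X (k+1) = X k + ε g(X k, U k)` driven by compactly valued i.i.d. noise `U`. -/
theorem ae_weak_exponential_stability {Ω E H Y : Type*} [MeasurableSpace Ω] {P : Measure Ω}
    [IsProbabilityMeasure P] [NormedAddCommGroup E] [NormedSpace ℝ E] [ProperSpace E]
    [CompleteSpace E] [NormedAddCommGroup H] [InnerProductSpace ℝ H]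
    [TopologicalSpace Y] [SecondCountableTopology Y] [MeasurableSpace Y]
    [OpensMeasurableSpace Y] {g : E → Y → E} {g' : E → Y → E →L[ℝ] E}
    (hg : Continuous (Function.uncurry g)) (hg' : Continuous (Function.uncurry g'))
    (hd : ∀ x y, HasFDerivAt (fun x => g x y) (g' x y) x)
    {U : ℕ → Ω → Y} (hU : ∀ k, Measurable (U k))
    (hind : Pairwise fun i j => IndepFun (U i) (U j) P)
    (hid : ∀ k, IdentDistrib (U k) (U 0) P P) {Q : Set Y} (hQ : IsCompact Q)
    (hUQ : ∀ k ω, U k ω ∈ Q) {e : E} (he : ∫ ω, g e (U 0 ω) ∂P = 0)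
    {J : E →L[ℝ] E} (hJ : HasFDerivAt (fun x => ∫ ω, g x (U 0 ω) ∂P) J e)
    {T : E →L[ℝ] H} {m lam : ℝ} (hm : 0 < m) (hmT : ∀ x, m * ‖x‖ ≤ ‖T x‖) (hlam : 0 < lam)
    (hdiss : ∀ x, inner ℝ (T x) (T (J x)) ≤ -lam * ‖T x‖ ^ 2) :
    ∃ r c κ : ℝ, 0 < r ∧ 0 < c ∧ 0 < κ ∧ ∀ᵐ ω ∂P, ∀ N : ℕ, ∀ δ : ℝ, 0 < δ →
      ∃ ε₂ : ℝ, 0 < ε₂ ∧ ∀ ε, 0 < ε → ε < ε₂ → ∀ X : ℕ → E,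
        (∀ k, X (k + 1) = X k + ε • g (X k) (U k ω)) → ‖X 0 - e‖ ≤ r → ∀ k : ℕ,
          k ≤ ⌊(N : ℝ) / ε⌋₊ → ‖X k - e‖ ≤ c * ‖X 0 - e‖ * (1 - κ * ε) ^ k + δ := by
  obtain ⟨R, κ, ε₁, hR, hκ, hε₁, hcontr⟩ := exists_euler_contraction hJ he hm hmT hlam hdiss
  obtain ⟨B, hB⟩ := (((isCompact_closedBall e R).prod hQ).image hg).isBounded.exists_norm_le
  obtain ⟨L, hL⟩ := (((isCompact_closedBall e R).prod hQ).image hg').isBounded.exists_norm_le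
  have hL' : ∀ x ∈ Metric.closedBall e R, ∀ ω, ‖g' x (U 0 ω)‖ ≤ |L| := fun x hx ω =>
    (hL _ ⟨(x, U 0 ω), ⟨hx, hUQ 0 ω⟩, rfl⟩).trans (le_abs_self L)
  -- The `+ 1` keeps `c` positive and makes both `r` and `‖T‖ / m * r` at most `R / 4`. The null set
  -- is discarded before `N`, `δ`, `ε` and the trajectory are chosen.
  refine ⟨R / 4 / (‖T‖ / m + 1), ‖T‖ / m + 1, κ, by positivity, by positivity, hκ, ?_⟩
  filter_upwards [ae_centred_sums_sublinear hg hg' hd hU hind hid hQ hUQ e R] with ω hω N δ hδ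
  have hr : R / 4 / (‖T‖ / m + 1) * (‖T‖ / m + 1) = R / 4 := by field_simp
  have hr0 : 0 < R / 4 / (‖T‖ / m + 1) := by positivity
  have hTm : 0 ≤ ‖T‖ / m := by positivity
  obtain ⟨ε₂, hε₂, h⟩ := pathwise_exponential_decay (T := T) (e := e)
    (Φ := fun x => ∫ ω, g x (U 0 ω) ∂P) (F := fun k x => g x (U k ω)) (B := |B|) (L := |L|)
    hm hmT hκ hR (abs_nonneg _) (abs_nonneg _) hε₁
    (fun x hx y hy => Convex.norm_image_sub_le_of_norm_hasFDerivWithin_le (𝕜 := ℝ)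
      (f := fun x => ∫ ω, g x (U 0 ω) ∂P)
      (fun z _ => (hasFDerivAt_expectation hg hg' hd (hU 0) hQ (hUQ 0) z).hasFDerivWithinAt)
      (fun z hz => by
        have h2 := norm_integral_le_of_norm_le_const (μ := P)
          (f := fun ω => g' z (U 0 ω)) (Eventually.of_forall (hL' z hz))
        simpa using h2)
      (convex_closedBall e R) hy hx)
    hcontr
    (fun k x hx => (hB _ ⟨(x, U k ω), ⟨hx, hUQ k ω⟩, rfl⟩).trans (le_abs_self B))
    hω (r := R / 4 / (‖T‖ / m + 1)) (by nlinarith) (by nlinarith) N hδ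
  refine ⟨min ε₂ (1 / κ), by positivity, fun ε hε hεε X hX hX0 k hk => ?_⟩
  rw [lt_min_iff, lt_div_iff₀ hκ] at hεε
  refine (h ε hε hεε.1 X hX hX0 k hk).trans ?_
  have h3 : 0 ≤ ‖X 0 - e‖ * (1 - κ * ε) ^ k :=
    mul_nonneg (norm_nonneg _) (pow_nonneg (by linarith) _)
  linarith

/-- A quadratic Lyapunov function for the linearization of the average field. -/
theorem exists_lyapunov_map {ϱ w₁ w₂ A B : ℝ} (hϱ : 0 < ϱ) (hw₁ : 0 < w₁) (hw₂ : 0 < w₂)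
    (hA : A < 0) {J : EuclideanSpace ℝ (Fin 3) →L[ℝ] EuclideanSpace ℝ (Fin 3)}
    (hJ : ∀ x, J x = !₂[ϱ * x 1, -w₁ * x 1 + w₁ * (A * x 0), -w₂ * x 2 + w₂ * (B * x 0)]) :
    ∃ T : EuclideanSpace ℝ (Fin 3) →L[ℝ] EuclideanSpace ℝ (Fin 4), ∃ m lam : ℝ, 0 < m ∧ 0 < lam ∧
      (∀ x, m * ‖x‖ ≤ ‖T x‖) ∧ ∀ x, inner ℝ (T x) (T (J x)) ≤ -lam * ‖T x‖ ^ 2 := by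
  set α : ℝ := -(w₁ * A) with hα
  have hα0 : 0 < α := by rw [hα]; nlinarith
  -- The weight of `x 2` is small enough for the coupling `μ w₂ B x₀ x₂` to be absorbed by
  -- completing the square, at the price of half the decay in `x 0`.
  set μ : ℝ := α * w₁ / (2 * w₂ * (B ^ 2 + 1)) with hμ
  have hμ0 : 0 < μ := by positivity
  have hμB : μ * w₂ * B ^ 2 ≤ α * w₁ / 2 := by
    have h1 : μ * w₂ * (B ^ 2 + 1) = α * w₁ / 2 := by rw [hμ]; field_simp
    nlinarith [mul_pos hμ0 hw₂]
  -- `‖T x‖²` is a sum of four squares. Along the linear flow `x₁ + (w₁/ϱ) x₀` has derivative `-α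
  -- x₀`, so the `x₀ x₁` cross terms of the first three squares cancel.
  let T : EuclideanSpace ℝ (Fin 3) →L[ℝ] EuclideanSpace ℝ (Fin 4) := LinearMap.toContinuousLinearMap
    { toFun := fun x => !₂[√α * x 0, √(ϱ / 2) * x 1, √(ϱ / 2) * (x 1 + w₁ / ϱ * x 0), √μ * x 2]
      map_add' := fun x y => by
        ext i; fin_cases i <;> simp <;> ring
      map_smul' := fun c x => by
        ext i; fin_cases i <;> simp <;> ring }
  have hT : ∀ x, T x =
    !₂[√α * x 0, √(ϱ / 2) * x 1, √(ϱ / 2) * (x 1 + w₁ / ϱ * x 0), √μ * x 2] := fun _ => rfl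
  have hinner : ∀ x y, inner ℝ (T x) (T y) = α * (x 0 * y 0) + ϱ / 2 * (x 1 * y 1) +
      ϱ / 2 * ((x 1 + w₁ / ϱ * x 0) * (y 1 + w₁ / ϱ * y 0)) + μ * (x 2 * y 2) := by
    intro x y
    have e1 := Real.mul_self_sqrt hα0.le
    have e2 := Real.mul_self_sqrt (half_pos hϱ).le
    have e3 := Real.mul_self_sqrt hμ0.le
    rw [hT, hT, PiLp.inner_apply, Fin.sum_univ_four]
    simp only [RCLike.inner_apply, conj_trivial, Matrix.cons_val]
    linear_combination (x 0 * y 0) * e1 + (x 1 * y 1) * e2 +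
      ((x 1 + w₁ / ϱ * x 0) * (y 1 + w₁ / ϱ * y 0)) * e2 + (x 2 * y 2) * e3
  have hnorm : ∀ x : EuclideanSpace ℝ (Fin 3), ‖x‖ ^ 2 = x 0 ^ 2 + x 1 ^ 2 + x 2 ^ 2 := by
    intro x
    rw [EuclideanSpace.real_norm_sq_eq, Fin.sum_univ_three]
  set m2 : ℝ := min α (min (ϱ / 2) μ) with hm2
  have hm20 : 0 < m2 := by positivity
  set l : ℝ := min (α * w₁ / 4) (min (ϱ * w₁ / 2) (μ * w₂ / 2)) with hl
  have hl0 : 0 < l := by positivity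
  refine ⟨T, √m2, l / (‖T‖ ^ 2 + 1), by positivity, by positivity, fun x => ?_, fun x => ?_⟩
  · refine le_of_sq_le_sq ?_ (norm_nonneg _)
    rw [mul_pow, Real.sq_sqrt hm20.le, hnorm, ← real_inner_self_eq_norm_sq, hinner]
    have h1 : m2 * x 0 ^ 2 ≤ α * x 0 ^ 2 :=
      mul_le_mul_of_nonneg_right (min_le_left _ _) (sq_nonneg _)
    have h2 : m2 * x 1 ^ 2 ≤ ϱ / 2 * x 1 ^ 2 :=
      mul_le_mul_of_nonneg_right ((min_le_right _ _).trans (min_le_left _ _)) (sq_nonneg _)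
    have h3 : m2 * x 2 ^ 2 ≤ μ * x 2 ^ 2 :=
      mul_le_mul_of_nonneg_right ((min_le_right _ _).trans (min_le_right _ _)) (sq_nonneg _)
    have h4 : 0 ≤ ϱ / 2 * ((x 1 + w₁ / ϱ * x 0) * (x 1 + w₁ / ϱ * x 0)) :=
      mul_nonneg (by positivity) (mul_self_nonneg _)
    linarith
  · have h1 : inner ℝ (T x) (T (J x)) ≤ -l * ‖x‖ ^ 2 := by
      rw [hinner, hJ, hnorm]
      simp only [Matrix.cons_val]
      have e1 : α * (x 0 * (ϱ * x 1)) + ϱ / 2 * (x 1 * (-w₁ * x 1 + w₁ * (A * x 0))) +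
          ϱ / 2 * ((x 1 + w₁ / ϱ * x 0) *
            (-w₁ * x 1 + w₁ * (A * x 0) + w₁ / ϱ * (ϱ * x 1))) =
          -(α * w₁ / 2) * x 0 ^ 2 - ϱ * w₁ / 2 * x 1 ^ 2 := by
        have e2 : w₁ * A = -α := by rw [hα]; ring
        have e3 : w₁ * (A * x 0) = -α * x 0 := by rw [← mul_assoc, e2]
        rw [e3]
        field_simp
        ring
      rw [e1]
      have h2 : l * x 0 ^ 2 ≤ α * w₁ / 4 * x 0 ^ 2 :=
        mul_le_mul_of_nonneg_right (min_le_left _ _) (sq_nonneg _)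
      have h3 : l * x 1 ^ 2 ≤ ϱ * w₁ / 2 * x 1 ^ 2 :=
        mul_le_mul_of_nonneg_right ((min_le_right _ _).trans (min_le_left _ _)) (sq_nonneg _)
      have h4 : l * x 2 ^ 2 ≤ μ * w₂ / 2 * x 2 ^ 2 :=
        mul_le_mul_of_nonneg_right ((min_le_right _ _).trans (min_le_right _ _)) (sq_nonneg _)
      have h5 : μ * w₂ * B ^ 2 * x 0 ^ 2 ≤ α * w₁ / 2 * x 0 ^ 2 :=
        mul_le_mul_of_nonneg_right hμB (sq_nonneg _)
      have h6 : 0 ≤ μ * w₂ / 2 * (x 2 - B * x 0) ^ 2 := by positivity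
      linarith
    refine h1.trans ?_
    have h2 : ‖T x‖ ^ 2 ≤ (‖T‖ ^ 2 + 1) * ‖x‖ ^ 2 := by
      have := pow_le_pow_left₀ (norm_nonneg _) (T.le_opNorm x) 2
      rw [mul_pow] at this
      nlinarith [sq_nonneg ‖x‖]
    have h3 := mul_le_mul_of_nonneg_left h2 (by positivity : 0 ≤ l / (‖T‖ ^ 2 + 1))
    have h4 : l / (‖T‖ ^ 2 + 1) * ((‖T‖ ^ 2 + 1) * ‖x‖ ^ 2) = l * ‖x‖ ^ 2 := by field_simp
    linarith

/-! ### The reduced field with compact noise and its average -/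

/-- The reduced field as a function of the state and of the noise pair `u = (sin y, w)`. -/
def noiseField (ς : ℝ → ℝ) (ϱ w₁ w₂ a : ℝ) (x : EuclideanSpace ℝ (Fin 3)) (u : ℝ × ℝ) :
    EuclideanSpace ℝ (Fin 3) :=
  !₂[ϱ * x 1,
    -w₁ * x 1 + w₁ * (ς (x 0 + a * u.1) - x 2 + u.2) * u.1,
    -w₂ * x 2 + w₂ * (ς (x 0 + a * u.1) + u.2)]

theorem contDiff_noiseField {ς : ℝ → ℝ} (hς : ContDiff ℝ 2 ς) (ϱ w₁ w₂ a : ℝ) :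
    ContDiff ℝ 2 (fun p : EuclideanSpace ℝ (Fin 3) × (ℝ × ℝ) =>
      noiseField ς ϱ w₁ w₂ a p.1 p.2) := by
  have hx : ∀ i : Fin 3, ContDiff ℝ 2 fun p : EuclideanSpace ℝ (Fin 3) × (ℝ × ℝ) => p.1 i :=
    fun i => (EuclideanSpace.proj (𝕜 := ℝ) i).contDiff.comp contDiff_fst
  have hx0 := hx 0
  have hx1 := hx 1
  have hx2 := hx 2
  have hs : ContDiff ℝ 2 fun p : EuclideanSpace ℝ (Fin 3) × (ℝ × ℝ) => ς (p.1 0 + a * p.2.1) :=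
    hς.comp (by fun_prop)
  rw [contDiff_euclidean]
  intro i
  fin_cases i
  · exact (by fun_prop : ContDiff ℝ 2 fun p : EuclideanSpace ℝ (Fin 3) × (ℝ × ℝ) => ϱ * p.1 1)
  · exact (by fun_prop : ContDiff ℝ 2 fun p : EuclideanSpace ℝ (Fin 3) × (ℝ × ℝ) =>
      -w₁ * p.1 1 + w₁ * (ς (p.1 0 + a * p.2.1) - p.1 2 + p.2.2) * p.2.1)
  · exact (by fun_prop : ContDiff ℝ 2 fun p : EuclideanSpace ℝ (Fin 3) × (ℝ × ℝ) =>
      -w₂ * p.1 2 + w₂ * (ς (p.1 0 + a * p.2.1) + p.2.2))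

section Average

variable {Ω : Type*} [MeasurableSpace Ω] {P : Measure Ω} [IsProbabilityMeasure P]

/-- The average field in terms of the correlation and the mean of `ς(θ + a s)`. -/
theorem integral_noiseField {s W : Ω → ℝ} (hs : Measurable s) (hs1 : ∀ ω, |s ω| ≤ 1)
    (hWm : Measurable W) {M : ℝ} (hWM : ∀ ω, |W ω| ≤ M)
    (hs0 : ∫ ω, s ω ∂P = 0) (hW0 : ∫ ω, W ω ∂P = 0) (hWs : ∫ ω, W ω * s ω ∂P = 0)
    {ς : ℝ → ℝ} (hς : ContDiff ℝ 2 ς) (ϱ w₁ w₂ a : ℝ) (x : EuclideanSpace ℝ (Fin 3)) :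
    ∫ ω, noiseField ς ϱ w₁ w₂ a x (s ω, W ω) ∂P =
      !₂[ϱ * x 1, -w₁ * x 1 + w₁ * ∫ ω, ς (x 0 + a * s ω) * s ω ∂P,
        -w₂ * x 2 + w₂ * ∫ ω, ς (x 0 + a * s ω) ∂P] := by
  have hςc := hς.continuous
  have hint : ∀ φ : ℝ → ℝ, Continuous φ → Integrable (fun ω => φ (s ω)) P := fun φ hφ =>
    integrable_comp_of_abs_le_one hs hs1 hφ
  have iW : Integrable W P :=
    Integrable.of_bound hWm.aestronglyMeasurable M (Eventually.of_forall hWM)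
  have iWs : Integrable (fun ω => W ω * s ω) P := by
    refine Integrable.of_bound (hWm.mul hs).aestronglyMeasurable M (Eventually.of_forall fun ω => ?_)
    rw [Real.norm_eq_abs, abs_mul]
    exact (mul_le_of_le_one_right (abs_nonneg _) (hs1 ω)).trans (hWM ω)
  have i1 : Integrable s P := hint _ continuous_id
  have i2 : Integrable (fun ω => ς (x 0 + a * s ω) * s ω) P :=
    hint _ (by fun_prop : Continuous fun y => ς (x 0 + a * y) * y)
  have i3 : Integrable (fun ω => ς (x 0 + a * s ω)) P :=
    hint _ (by fun_prop : Continuous fun y => ς (x 0 + a * y))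
  have j1 : Integrable (fun ω => w₁ * (W ω * s ω) - w₁ * x 2 * s ω) P :=
    (iWs.const_mul _).sub (i1.const_mul _)
  have j2 : Integrable (fun ω => w₁ * (ς (x 0 + a * s ω) * s ω) +
      (w₁ * (W ω * s ω) - w₁ * x 2 * s ω)) P := (i2.const_mul _).add j1
  have j3 : Integrable (fun ω => w₂ * ς (x 0 + a * s ω) + w₂ * W ω) P :=
    (i3.const_mul _).add (iW.const_mul _)
  have c0 : ∀ ω, noiseField ς ϱ w₁ w₂ a x (s ω, W ω) 0 = ϱ * x 1 := fun _ => rfl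
  have c1 : ∀ ω, noiseField ς ϱ w₁ w₂ a x (s ω, W ω) 1 = -w₁ * x 1 +
      (w₁ * (ς (x 0 + a * s ω) * s ω) + (w₁ * (W ω * s ω) - w₁ * x 2 * s ω)) := fun ω => by
    change -w₁ * x 1 + w₁ * (ς (x 0 + a * s ω) - x 2 + W ω) * s ω = _
    ring
  have c2 : ∀ ω, noiseField ς ϱ w₁ w₂ a x (s ω, W ω) 2 =
      -w₂ * x 2 + (w₂ * ς (x 0 + a * s ω) + w₂ * W ω) := fun ω => by
    change -w₂ * x 2 + w₂ * (ς (x 0 + a * s ω) + W ω) = _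
    ring
  have hF : Integrable (fun ω => noiseField ς ϱ w₁ w₂ a x (s ω, W ω)) P := by
    have hc : Continuous fun u => noiseField ς ϱ w₁ w₂ a x u :=
      (contDiff_noiseField hς ϱ w₁ w₂ a).continuous.comp (by fun_prop : Continuous fun u => (x, u))
    obtain ⟨B, hB⟩ := ((isCompact_Icc (a := (-1 : ℝ)) (b := 1)).prod
      (isCompact_Icc (a := -M) (b := M)) |>.image hc).isBounded.exists_norm_le
    exact Integrable.of_bound
      (hc.stronglyMeasurable.comp_measurable (hs.prodMk hWm)).aestronglyMeasurable B
      (Eventually.of_forall fun ω => hB _ ⟨_, ⟨abs_le.1 (hs1 ω), abs_le.1 (hWM ω)⟩, rfl⟩)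
  have hi : ∀ i : Fin 3, (∫ ω, noiseField ς ϱ w₁ w₂ a x (s ω, W ω) ∂P) i =
      ∫ ω, noiseField ς ϱ w₁ w₂ a x (s ω, W ω) i ∂P := fun i =>
    ((EuclideanSpace.proj (𝕜 := ℝ) i).integral_comp_comm hF).symm
  ext i
  rw [hi]
  fin_cases i
  · simp only [Fin.zero_eta, c0]
    simp
  · simp only [Fin.mk_one, c1]
    rw [integral_add (integrable_const _) j2, integral_add (i2.const_mul _) j1,
      integral_sub (iWs.const_mul _) (i1.const_mul _), integral_const_mul, integral_const_mul,
      integral_const_mul, integral_const_mul, hWs, hs0]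
    simp
  · simp only [Fin.reduceFinMk, c2]
    rw [integral_add (integrable_const _) j3,
      integral_add (i3.const_mul _) (iW.const_mul _), integral_const_mul, integral_const_mul,
      integral_const_mul, hW0]
    simp

/-- The derivative of a field of the form of the average field, in terms of the derivatives of
the correlation and of the mean. -/
theorem fderiv_average_apply {g k : ℝ → ℝ} {A B ϱ w₁ w₂ : ℝ} {e : EuclideanSpace ℝ (Fin 3)}
    (hg : HasDerivAt g A (e 0)) (hk : HasDerivAt k B (e 0))
    {J : EuclideanSpace ℝ (Fin 3) →L[ℝ] EuclideanSpace ℝ (Fin 3)}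
    (hJ : HasFDerivAt (fun x : EuclideanSpace ℝ (Fin 3) =>
      (!₂[ϱ * x 1, -w₁ * x 1 + w₁ * g (x 0), -w₂ * x 2 + w₂ * k (x 0)] :
        EuclideanSpace ℝ (Fin 3))) J e) (x : EuclideanSpace ℝ (Fin 3)) :
    J x = !₂[ϱ * x 1, -w₁ * x 1 + w₁ * (A * x 0), -w₂ * x 2 + w₂ * (B * x 0)] := by
  have hline : ∀ i : Fin 3, HasDerivAt (fun t : ℝ => e i + t * x i) (x i) 0 := fun i => by
    simpa using ((hasDerivAt_id (0 : ℝ)).mul_const (x i)).const_add (e i)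
  have hg' : HasDerivAt (fun t : ℝ => g (e 0 + t * x 0)) (A * x 0) 0 :=
    HasDerivAt.comp (h₂ := g) 0 (by simpa using hg) (hline 0)
  have hk' : HasDerivAt (fun t : ℝ => k (e 0 + t * x 0)) (B * x 0) 0 :=
    HasDerivAt.comp (h₂ := k) 0 (by simpa using hk) (hline 0)
  -- `J` is identified through its line derivatives, coordinate by coordinate, by uniqueness of
  -- derivatives.
  have hJl := hJ.hasLineDerivAt x
  have hcomp : ∀ i : Fin 3, HasDerivAt (fun t : ℝ =>
      (!₂[ϱ * (e + t • x) 1, -w₁ * (e + t • x) 1 + w₁ * g ((e + t • x) 0),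
        -w₂ * (e + t • x) 2 + w₂ * k ((e + t • x) 0)] : EuclideanSpace ℝ (Fin 3)) i) (J x i) 0 :=
    fun i => (EuclideanSpace.proj (𝕜 := ℝ) i).hasFDerivAt.comp_hasDerivAt 0 hJl
  ext i
  fin_cases i
  · exact (hcomp 0).unique ((hline 1).const_mul ϱ)
  · exact (hcomp 1).unique (((hline 1).const_mul (-w₁)).add (hg'.const_mul w₁))
  · exact (hcomp 2).unique (((hline 2).const_mul (-w₂)).add (hk'.const_mul w₂))

end Average

/-! ### From pathwise bounds to exit times and probabilities -/

theorem measurable_reducedTraj {Ω : Type*} [MeasurableSpace Ω] {ς : ℝ → ℝ} (hς : ContDiff ℝ 2 ς)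
    (ϱ w₁ w₂ a ε : ℝ) {v W : ℕ → Ω → ℝ} (hv : ∀ k, Measurable (v k)) (hW : ∀ k, Measurable (W k))
    (x₀ : EuclideanSpace ℝ (Fin 3)) (k : ℕ) : Measurable fun ω =>
      reducedTraj ς ϱ w₁ w₂ a ε (fun j => v j ω) (fun j => W j ω) x₀ k := by
  induction k with
  | zero => exact measurable_const
  | succ k ih =>
    refine ih.add (Measurable.const_smul ?_ ε)
    exact (contDiff_noiseField hς ϱ w₁ w₂ a).continuous.measurable.comp
      (ih.prodMk ((Real.measurable_sin.comp (hv (k + 1))).prodMk (hW (k + 1))))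

/-- If the bound holds up to time `⌊N / ε⌋` for all small `ε`, the first exit time tends to `⊤`. -/
theorem tendsto_firstExit_top {Δ : ℝ → ℕ → EuclideanSpace ℝ (Fin 3)} {b : ℝ → ℕ → ℝ}
    (h : ∀ᶠ ε in 𝓝[>] (0 : ℝ), ∀ k : ℕ, k ≤ ⌊((1 : ℕ) : ℝ) / ε⌋₊ → ‖Δ ε k‖ ≤ b ε k) :
    Tendsto (fun ε => firstExit (Δ ε) (b ε)) (𝓝[>] 0) (𝓝 ⊤) := by
  rw [ENat.tendsto_nhds_top_iff_natCast_lt]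
  intro n
  -- Horizon `1 / ε` suffices: for `ε < 1 / (n + 2)` it exceeds `n + 1`, so there is no exit up to
  -- time `n`.
  have hsmall : ∀ᶠ ε in 𝓝[>] (0 : ℝ), 0 < ε ∧ ε < 1 / ((n : ℝ) + 2) :=
    eventually_mem_nhdsWithin.and (eventually_nhdsWithin_of_eventually_nhds
      (eventually_lt_nhds (by positivity)))
  filter_upwards [h, hsmall] with ε hε hε2
  have hfl : n + 1 ≤ ⌊((1 : ℕ) : ℝ) / ε⌋₊ := by
    refine Nat.le_floor ?_
    have := hε2.2
    rw [lt_div_iff₀ (by positivity)] at this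
    rw [le_div_iff₀ hε2.1]
    push_cast
    nlinarith [hε2.1]
  have hle : ((n + 1 : ℕ) : ℕ∞) ≤ firstExit (Δ ε) (b ε) := by
    refine le_iInf₂ fun k hk => ?_
    by_contra hlt
    have hk2 : k < n + 1 := by
      rw [not_le] at hlt
      exact_mod_cast hlt
    exact absurd (hε k (by omega)) (not_le.2 hk)
  refine lt_of_lt_of_le ?_ hle
  exact_mod_cast Nat.lt_succ_self n

/-- Convergence in probability from almost sure eventual validity. -/
theorem tendsto_measure_one_of_ae_eventually {Ω : Type*} [MeasurableSpace Ω] {P : Measure Ω}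
    [IsProbabilityMeasure P] {ι : Type*} {l : Filter ι} [l.IsCountablyGenerated] {A : ι → Set Ω}
    (hA : ∀ i, MeasurableSet (A i)) (h : ∀ᵐ ω ∂P, ∀ᶠ i in l, ω ∈ A i) :
    Tendsto (fun i => P (A i)) l (𝓝 1) := by
  rw [← measure_univ (μ := P)]
  refine tendsto_measure_of_ae_tendsto_indicator_of_isFiniteMeasure l MeasurableSet.univ hA ?_
  filter_upwards [h] with ω hω
  filter_upwards [hω] with i hi
  simpa using hi

theorem indepFun_comp_pair {Ω β : Type*} [MeasurableSpace Ω] [MeasurableSpace β] {P : Measure Ω}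
    [IsProbabilityMeasure P] {v W : ℕ → Ω → ℝ} (hvm : ∀ k, Measurable (v k))
    (hWm : ∀ k, Measurable (W k)) (hvW : IndepFun (fun ω k => v k ω) (fun ω k => W k ω) P)
    (hv : iIndepFun v P) (hW : iIndepFun W P) {φ : ℝ × ℝ → β} (hφ : Measurable φ) {i j : ℕ}
    (hij : i ≠ j) : IndepFun (fun ω => φ (v i ω, W i ω)) (fun ω => φ (v j ω, W j ω)) P :=
  (indepFun_pair hvm hWm hvW (hv.indepFun hij) (hW.indepFun hij)).comp hφ hφ

theorem identDistrib_comp_pair {Ω β : Type*} [MeasurableSpace Ω] [MeasurableSpace β] {P : Measure Ω}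
    {v v' W W' : Ω → ℝ} (hv : Measurable v) (hW : Measurable W) (hv' : Measurable v')
    (hW' : Measurable W')
    (h : P.map (fun ω => (v ω, W ω)) = P.map (fun ω => (v' ω, W' ω))) {φ : ℝ × ℝ → β}
    (hφ : Measurable φ) :
    IdentDistrib (fun ω => φ (v ω, W ω)) (fun ω => φ (v' ω, W' ω)) P P :=
  IdentDistrib.comp ⟨(hv.prodMk hW).aemeasurable, (hv'.prodMk hW').aemeasurable, h⟩ hφ

theorem contDiff_shiftedMap {E : Type*} [NormedAddCommGroup E] [NormedSpace ℝ E] {h : E → ℝ}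
    {l : ℝ → E} {n : WithTop ℕ∞} (hh : ContDiff ℝ n h) (hl : ContDiff ℝ n l) (θs : ℝ) :
    ContDiff ℝ n (shiftedMap h l θs) :=
  (hh.comp (hl.comp (contDiff_const.add contDiff_id))).sub contDiff_const

/-- The subtracted constant disappears only after one differentiation, hence the order `n + 1`. -/
theorem iteratedDeriv_shiftedMap {E : Type*} {h : E → ℝ} {l : ℝ → E} (n : ℕ) (θs : ℝ) :
    iteratedDeriv (n + 1) (shiftedMap h l θs) 0 = iteratedDeriv (n + 1) (h ∘ l) θs := by
  have h1 : deriv (shiftedMap h l θs) = fun s => deriv (h ∘ l) (θs + s) := by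
    ext s
    unfold shiftedMap
    rw [deriv_sub_const]
    exact deriv_comp_const_add (h ∘ l) θs s
  rw [iteratedDeriv_succ', iteratedDeriv_succ', h1, iteratedDeriv_comp_const_add]
  simp

/-- Weak exponential stability of `e = (θ, 0, E[ς(θ + a s)])` for the reduced system, when `θ` is a
zero of the correlation `E[ς(θ + a s) s]` with negative derivative. The noise pairs are
`U k = (sin (v (k+1)), W (k+1))`. -/
theorem ae_reduced_stability {Ω : Type*} [MeasurableSpace Ω] {P : Measure Ω}
    [IsProbabilityMeasure P] {ς : ℝ → ℝ} (hς : ContDiff ℝ 2 ς) {ϱ w₁ w₂ : ℝ} (hϱ : 0 < ϱ)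
    (hw₁ : 0 < w₁) (hw₂ : 0 < w₂) {a θ : ℝ} {U : ℕ → Ω → ℝ × ℝ} (hU : ∀ k, Measurable (U k))
    (hind : Pairwise fun i j => IndepFun (U i) (U j) P)
    (hid : ∀ k, IdentDistrib (U k) (U 0) P P) {M : ℝ}
    (hUQ : ∀ k ω, U k ω ∈ Set.Icc (-1 : ℝ) 1 ×ˢ Set.Icc (-M) M)
    (hs0 : ∫ ω, (U 0 ω).1 ∂P = 0) (hW0 : ∫ ω, (U 0 ω).2 ∂P = 0)
    (hWs : ∫ ω, (U 0 ω).2 * (U 0 ω).1 ∂P = 0)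
    (hzero : ∫ ω, ς (θ + a * (U 0 ω).1) * (U 0 ω).1 ∂P = 0)
    (hA : ∫ ω, deriv ς (θ + a * (U 0 ω).1) * (U 0 ω).1 ∂P < 0)
    {e : EuclideanSpace ℝ (Fin 3)} (he : e = !₂[θ, 0, ∫ ω, ς (θ + a * (U 0 ω).1) ∂P]) :
    ∫ ω, noiseField ς ϱ w₁ w₂ a e (U 0 ω) ∂P = 0 ∧
    ∃ r c κ : ℝ, 0 < r ∧ 0 < c ∧ 0 < κ ∧ ∀ᵐ ω ∂P, ∀ N : ℕ, ∀ δ : ℝ, 0 < δ →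
      ∃ ε₂ : ℝ, 0 < ε₂ ∧ ∀ ε, 0 < ε → ε < ε₂ → ∀ X : ℕ → EuclideanSpace ℝ (Fin 3),
        (∀ k, X (k + 1) = X k + ε • noiseField ς ϱ w₁ w₂ a (X k) (U k ω)) → ‖X 0 - e‖ ≤ r →
        ∀ k : ℕ, k ≤ ⌊(N : ℝ) / ε⌋₊ → ‖X k - e‖ ≤ c * ‖X 0 - e‖ * (1 - κ * ε) ^ k + δ := by
  have hQ : IsCompact (Set.Icc (-1 : ℝ) 1 ×ˢ Set.Icc (-M) M) := isCompact_Icc.prod isCompact_Icc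
  have hs : Measurable fun ω => (U 0 ω).1 := (hU 0).fst
  have hWm : Measurable fun ω => (U 0 ω).2 := (hU 0).snd
  have hs1 : ∀ ω, |(U 0 ω).1| ≤ 1 := fun ω => abs_le.2 (hUQ 0 ω).1
  have hWM : ∀ ω, |(U 0 ω).2| ≤ M := fun ω => abs_le.2 (hUQ 0 ω).2
  have hΦ : ∀ x, ∫ ω, noiseField ς ϱ w₁ w₂ a x (U 0 ω) ∂P =
      !₂[ϱ * x 1, -w₁ * x 1 + w₁ * ∫ ω, ς (x 0 + a * (U 0 ω).1) * (U 0 ω).1 ∂P,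
        -w₂ * x 2 + w₂ * ∫ ω, ς (x 0 + a * (U 0 ω).1) ∂P] := fun x =>
    integral_noiseField hs hs1 hWm hWM hs0 hW0 hWs hς ϱ w₁ w₂ a x
  have heΦ : ∫ ω, noiseField ς ϱ w₁ w₂ a e (U 0 ω) ∂P = 0 := by
    rw [hΦ]
    ext i
    fin_cases i <;> simp [he, hzero]
  have hcd := contDiff_noiseField hς ϱ w₁ w₂ a
  have hg' : Continuous (Function.uncurry fun (x : EuclideanSpace ℝ (Fin 3)) (u : ℝ × ℝ) =>
      fderiv ℝ (fun x => noiseField ς ϱ w₁ w₂ a x u) x) :=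
    (ContDiff.fderiv (n := 1) (m := 2)
      (f := fun (p : EuclideanSpace ℝ (Fin 3) × (ℝ × ℝ)) (x : EuclideanSpace ℝ (Fin 3)) =>
        noiseField ς ϱ w₁ w₂ a x p.2)
      (hcd.comp (by fun_prop : ContDiff ℝ 2
        fun q : (EuclideanSpace ℝ (Fin 3) × (ℝ × ℝ)) × EuclideanSpace ℝ (Fin 3) => (q.2, q.1.2)))
      contDiff_fst (by norm_num)).continuous
  have hd : ∀ (x : EuclideanSpace ℝ (Fin 3)) (u : ℝ × ℝ),
      HasFDerivAt (fun x => noiseField ς ϱ w₁ w₂ a x u)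
        (fderiv ℝ (fun x => noiseField ς ϱ w₁ w₂ a x u) x) x := fun x u =>
    ((hcd.comp (by fun_prop : ContDiff ℝ 2 fun x : EuclideanSpace ℝ (Fin 3) => (x, u))).differentiable
      (by norm_num) x).hasFDerivAt
  have hJ := hasFDerivAt_expectation (P := P) hcd.continuous hg' hd (hU 0) hQ (hUQ 0) e
  -- Only the sign of the correlation's derivative matters; the derivative of the mean is arbitrary,
  -- as `ζ` does not feed back into the averaged `(θ, ξ)` dynamics.
  have hJx := fderiv_average_apply
    (hasDerivAt_expectation_comp (P := P) hs hs1 (hς.of_le (by norm_num)) (q := fun y => y)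
      continuous_id a (e 0))
    (by
      simpa using hasDerivAt_expectation_comp (P := P) hs hs1 (hς.of_le (by norm_num))
        (q := fun _ => 1) continuous_const a (e 0))
    (by simpa only [hΦ] using hJ)
  have he0 : e 0 = θ := by rw [he]; rfl
  simp only [he0] at hJx
  obtain ⟨T, m, lam, hm, hlam, hmT, hdiss⟩ := exists_lyapunov_map hϱ hw₁ hw₂ hA hJx
  exact ⟨heΦ, ae_weak_exponential_stability (P := P)
    hcd.continuous hg' hd hU hind hid hQ hUQ heΦ hJ hm hmT hlam hdiss⟩

end StochES

/-! ### Assembly of the theorem -/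

theorem theorem11 {n : ℕ}
    -- the plant `x⁺ = f(x, u)`, `y = h(x)`, the control law `u = β(x, θ)`, the equilibrium map `l`
    (f : EuclideanSpace ℝ (Fin n) → ℝ → EuclideanSpace ℝ (Fin n))
    (h : EuclideanSpace ℝ (Fin n) → ℝ) (β : EuclideanSpace ℝ (Fin n) → ℝ → ℝ)
    (l : ℝ → EuclideanSpace ℝ (Fin n))
    (hf : ContDiff ℝ (⊤ : ℕ∞) (fun p : EuclideanSpace ℝ (Fin n) × ℝ => f p.1 p.2))
    (hh : ContDiff ℝ (⊤ : ℕ∞) h)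
    (hβ : ContDiff ℝ (⊤ : ℕ∞) (fun p : EuclideanSpace ℝ (Fin n) × ℝ => β p.1 p.2))
    (hl : ContDiff ℝ (⊤ : ℕ∞) l)
    (heq : ∀ (θ : ℝ) (x : EuclideanSpace ℝ (Fin n)), f x (β x θ) = x ↔ x = l θ)
    -- the local maximum of the output equilibrium map
    (θs : ℝ) (hd1 : deriv (h ∘ l) θs = 0) (hd2 : iteratedDeriv 2 (h ∘ l) θs < 0)
    -- the design parameters and the parameters of the random signals
    (ϱ w₁ w₂ : ℝ) (hϱ : 0 < ϱ) (hw₁ : 0 < w₁) (hw₂ : 0 < w₂)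
    (σ σ₁ : ℝ≥0) (hσ : 0 < σ) (hσ₁ : 0 < σ₁) (M : ℝ) (hM : 0 ≤ M)
    -- the probing signal `v` and the measurement noise `W k = (-M) ∨ Z k ∧ M`
    {Ω : Type*} [MeasurableSpace Ω] (P : Measure Ω) [IsProbabilityMeasure P]
    (v Z W : ℕ → Ω → ℝ)
    (hvm : ∀ k, Measurable (v k)) (hZm : ∀ k, Measurable (Z k))
    (hv : ∀ k, P.map (v k) = gaussianReal 0 (σ ^ 2)) (hvi : iIndepFun v P)
    (hZ : ∀ k, P.map (Z k) = gaussianReal 0 (σ₁ ^ 2)) (hZi : iIndepFun Z P)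
    (hW : ∀ k ω, W k ω = StochES.truncate M (Z k ω))
    (hvW : IndepFun (fun ω k => v k ω) (fun ω k => W k ω) P)
    (ς : ℝ → ℝ) (hς : ς = StochES.shiftedMap h l θs) :
    ∃ aStar : ℝ, 0 < aStar ∧ ∃ θe ζe : ℝ → ℝ,
      -- the asymptotic expansion of the average equilibrium `(θe a, 0, ζe a)`
      (fun a : ℝ => θe a -
          (-(iteratedDeriv 3 ς 0 *
              (3 - 4 * Real.exp (-2 * (σ : ℝ) ^ 2) + Real.exp (-8 * (σ : ℝ) ^ 2))) /
            (24 * iteratedDeriv 2 ς 0 * (1 - Real.exp (-2 * (σ : ℝ) ^ 2)))) * a ^ 2)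
        =O[𝓝[>] 0] (fun a : ℝ => a ^ 3) ∧
      (fun a : ℝ => ζe a -
          iteratedDeriv 2 ς 0 * (1 - Real.exp (-2 * (σ : ℝ) ^ 2)) / 4 * a ^ 2)
        =O[𝓝[>] 0] (fun a : ℝ => a ^ 3) ∧
      ∀ a : ℝ, 0 < a → a < aStar →
        StochES.IsAverageEquilibrium ς ϱ w₁ w₂ a σ σ₁ M !₂[θe a, 0, ζe a] ∧
        ∃ ε₀ : ℝ, 0 < ε₀ ∧ ∃ r c γ : ℝ → ℝ,
          (∀ ε : ℝ, 0 < ε → ε < ε₀ → 0 < r ε ∧ 0 < c ε ∧ 0 < γ ε ∧ γ ε < 1) ∧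
          -- the constants do not degenerate as `ε → 0`
          (∃ r₀ c₀ κ : ℝ, 0 < r₀ ∧ 0 < c₀ ∧ 0 < κ ∧ ∀ ε : ℝ, 0 < ε → ε < ε₀ →
            r₀ ≤ r ε ∧ c ε ≤ c₀ ∧ γ ε ≤ Real.exp (-κ * ε)) ∧
          -- `x ε` is the initial condition, `Δ ε ω k` the deviation from the average equilibrium
          ∀ x : ℝ → EuclideanSpace ℝ (Fin 3),
            (∀ ε : ℝ, 0 < ε → ε < ε₀ → ‖x ε - !₂[θe a, 0, ζe a]‖ < r ε) →
            ∀ Δ : ℝ → Ω → ℕ → EuclideanSpace ℝ (Fin 3),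
              (∀ ε ω k, Δ ε ω k =
                StochES.reducedTraj ς ϱ w₁ w₂ a ε (fun j => v j ω) (fun j => W j ω) (x ε) k -
                  !₂[θe a, 0, ζe a]) →
            ∀ δ : ℝ, 0 < δ →
              (∀ᵐ ω ∂P, Tendsto
                (fun ε : ℝ => StochES.firstExit (Δ ε ω)
                  (fun k => c ε * ‖Δ ε ω 0‖ * γ ε ^ k + δ))
                (𝓝[>] 0) (𝓝 ⊤)) ∧
              ∀ N : ℕ, Tendsto
                (fun ε : ℝ => P {ω | ∀ k : ℕ, k ≤ ⌊(N : ℝ) / ε⌋₊ →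
                  ‖Δ ε ω k‖ ≤ c ε * ‖Δ ε ω 0‖ * γ ε ^ k + δ})
                (𝓝[>] 0) (𝓝 1) := by
  have hς2 : ContDiff ℝ (⊤ : ℕ∞) ς := hς ▸ StochES.contDiff_shiftedMap hh hl θs
  have hςd : ∀ m : ℕ, ContDiff ℝ m ς := fun m => hς2.of_le (by exact_mod_cast le_top)
  have hς0 : ς 0 = 0 := by simp [hς, StochES.shiftedMap]
  have hς1 : deriv ς 0 = 0 := by
    have := StochES.iteratedDeriv_shiftedMap (h := h) (l := l) 0 θs
    simpa [← hς, iteratedDeriv_one, hd1] using this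
  have hneg : iteratedDeriv 2 ς 0 < 0 := by
    have := StochES.iteratedDeriv_shiftedMap (h := h) (l := l) 1 θs
    rw [← hς] at this
    rwa [this]
  have hWeq : ∀ k, W k = StochES.truncate M ∘ Z k := fun k => funext (hW k)
  have htm : Measurable (StochES.truncate M) := (StochES.continuous_truncate M).measurable
  have hWm : ∀ k, Measurable (W k) := fun k => by
    rw [hWeq]; exact htm.comp (hZm k)
  have hWM : ∀ k ω, |W k ω| ≤ M := fun k ω => by
    rw [hW]; exact StochES.abs_truncate_le hM _
  have hWlaw : ∀ k, P.map (W k) = (gaussianReal 0 (σ₁ ^ 2)).map (StochES.truncate M) := fun k => by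
    rw [hWeq, ← Measure.map_map htm (hZm k), hZ]
  have hvWk : ∀ k, IndepFun (v k) (W k) P := fun k =>
    hvW.comp (measurable_pi_apply k) (measurable_pi_apply k)
  have hpair : ∀ k, P.map (fun ω => (v k ω, W k ω)) =
      (gaussianReal 0 (σ ^ 2)).prod ((gaussianReal 0 (σ₁ ^ 2)).map (StochES.truncate M)) :=
    fun k => by
      rw [(indepFun_iff_map_prod_eq_prod_map_map (hvm k).aemeasurable (hWm k).aemeasurable).1
        (hvWk k), hv, hWlaw]
  -- the noise pairs
  let U : ℕ → Ω → ℝ × ℝ := fun k ω => (Real.sin (v (k + 1) ω), W (k + 1) ω)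
  have hU : ∀ k, Measurable (U k) := fun k =>
    (Real.measurable_sin.comp (hvm (k + 1))).prodMk (hWm (k + 1))
  have hWi : iIndepFun W P := by
    rw [funext hWeq]
    exact hZi.comp _ fun _ => htm
  have hφ : Measurable fun p : ℝ × ℝ => (Real.sin p.1, p.2) := by fun_prop
  have hind : Pairwise fun i j => IndepFun (U i) (U j) P := fun i j hij =>
    StochES.indepFun_comp_pair hvm hWm hvW hvi hWi hφ
      (by simpa using hij : i + 1 ≠ j + 1)
  have hid : ∀ k, IdentDistrib (U k) (U 0) P P := fun k =>
    StochES.identDistrib_comp_pair (hvm _) (hWm _) (hvm _) (hWm _)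
      (by rw [hpair (k + 1), hpair (0 + 1)]) hφ
  have hUQ : ∀ k ω, U k ω ∈ Set.Icc (-1 : ℝ) 1 ×ˢ Set.Icc (-M) M := fun k ω =>
    ⟨abs_le.1 (Real.abs_sin_le_one _), abs_le.1 (hWM _ _)⟩
  -- moments of the noise
  let s : Ω → ℝ := fun ω => Real.sin (v 1 ω)
  have hs : Measurable s := Real.measurable_sin.comp (hvm 1)
  have hs1 : ∀ ω, |s ω| ≤ 1 := fun ω => Real.abs_sin_le_one _
  have hmom : ∀ j : ℕ, ∫ ω, s ω ^ j ∂P = ∫ y, Real.sin y ^ j ∂(gaussianReal 0 (σ ^ 2)) := by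
    intro j
    rw [← hv 1, integral_map (hvm 1).aemeasurable (by fun_prop)]
  have m1 : ∫ ω, s ω ∂P = 0 := by
    have := hmom 1
    simp only [pow_one] at this
    rw [this]
    exact StochES.integral_gaussianReal_odd Real.sin_neg
  have m2 := (hmom 2).trans (StochES.integral_gaussianReal_sin_sq σ)
  have m3 : ∫ ω, s ω ^ 3 ∂P = 0 := by
    rw [hmom]
    exact StochES.integral_gaussianReal_odd fun y => by rw [Real.sin_neg]; ring
  have m4 := (hmom 4).trans (StochES.integral_gaussianReal_sin_pow_four σ)
  have hm2 : 0 < (1 - Real.exp (-2 * (σ : ℝ) ^ 2)) / 2 := by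
    have hσ' : (0 : ℝ) < σ := hσ
    have : Real.exp (-2 * (σ : ℝ) ^ 2) < 1 := Real.exp_lt_one_iff.2 (by nlinarith [pow_pos hσ' 2])
    linarith
  have hW0 : ∫ ω, W 1 ω ∂P = 0 := by
    have : ∫ ω, W 1 ω ∂P = ∫ y, y ∂(P.map (W 1)) :=
      (integral_map (hWm 1).aemeasurable (f := fun y : ℝ => y) (by fun_prop)).symm
    rw [this, hWlaw, integral_map htm.aemeasurable (by fun_prop)]
    exact StochES.integral_gaussianReal_odd (StochES.truncate_neg hM)
  have hWs : ∫ ω, W 1 ω * s ω ∂P = 0 := by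
    have hi : IndepFun (W 1) s P := (hvWk 1).symm.comp measurable_id Real.measurable_sin
    rw [hi.integral_fun_mul_eq_mul_integral (hWm 1).aestronglyMeasurable hs.aestronglyMeasurable,
      hW0, zero_mul]
  obtain ⟨aStar, haS, θe, hθ, hζ, hae⟩ := StochES.exists_zero_expansion hs hs1 m1 m2 m3 m4 hm2
    (hςd 4) hς0 hς1 rfl rfl hneg
  refine ⟨aStar, haS, θe, fun a => ∫ ω, ς (θe a + a * s ω) ∂P, ?_, ?_, fun a ha haa => ?_⟩
  -- The factor `24` arises from `m₄ / (6 m₂)`, where `m₄` carries `1/8` and `m₂` carries `1/2`.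
  · convert hθ using 4
    have h1 : (1 - Real.exp (-2 * (σ : ℝ) ^ 2)) ≠ 0 := by
      intro h0; rw [h0] at hm2; simp at hm2
    have h2 := hneg.ne
    field_simp
    ring
  · convert hζ using 4
    ring
  obtain ⟨hzero, hA⟩ := hae a ha haa
  set e : EuclideanSpace ℝ (Fin 3) := !₂[θe a, 0, ∫ ω, ς (θe a + a * s ω) ∂P] with he
  have hcd := StochES.contDiff_noiseField (hςd 2) ϱ w₁ w₂ a
  obtain ⟨heΦ, r, c, κ, hr, hc, hκ, hstab⟩ := StochES.ae_reduced_stability (P := P) (hςd 2) hϱ hw₁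
    hw₂ hU hind hid hUQ m1 hW0 hWs hzero hA he
  refine ⟨?_, ?_⟩
  · unfold StochES.IsAverageEquilibrium StochES.averageField
    rw [← hpair 1, integral_map ((hvm 1).prodMk (hWm 1)).aemeasurable]
    · exact heΦ
    · exact (hcd.continuous.comp (by fun_prop :
        Continuous fun p : ℝ × ℝ => (e, (Real.sin p.1, p.2)))).aestronglyMeasurable
  have hγ : ∀ ε : ℝ, 0 < ε → ε < 1 / κ → 0 < 1 - κ * ε ∧ 1 - κ * ε < 1 := by
    intro ε hε hε1
    rw [lt_div_iff₀ hκ] at hε1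
    have := mul_pos hκ hε
    constructor <;> linarith
  -- `r` and `c` are constant in `ε`; `γ = 1 - κ ε` is positive below `1 / κ` and at most `e^{-κ
  -- ε}`.
  refine ⟨1 / κ, by positivity, fun _ => r, fun _ => c, fun ε => 1 - κ * ε,
    fun ε hε hε1 => ⟨hr, hc, hγ ε hε hε1⟩, ⟨r, c, κ, hr, hc, hκ, fun ε _ _ => ⟨le_rfl, le_rfl, ?_⟩⟩,
    fun x hx Δ hΔ δ hδ => ?_⟩
  · have := Real.add_one_le_exp (-κ * ε)
    linarith
  -- The threshold `ε₂` depends on the path but not on the trajectory, so initial conditions varying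
  -- with `ε` are allowed.
  have hev : ∀ᵐ ω ∂P, ∀ N : ℕ, ∀ᶠ ε in 𝓝[>] (0 : ℝ), ∀ k : ℕ, k ≤ ⌊(N : ℝ) / ε⌋₊ →
      ‖Δ ε ω k‖ ≤ c * ‖Δ ε ω 0‖ * (1 - κ * ε) ^ k + δ := by
    filter_upwards [hstab] with ω hω N
    obtain ⟨ε₂, hε₂, h2⟩ := hω N δ hδ
    have hsmall : ∀ᶠ ε in 𝓝[>] (0 : ℝ), 0 < ε ∧ ε < ε₂ ∧ ε < 1 / κ :=
      eventually_mem_nhdsWithin.and (eventually_nhdsWithin_of_eventually_nhds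
        ((eventually_lt_nhds hε₂).and (eventually_lt_nhds (by positivity))))
    filter_upwards [hsmall] with ε ⟨hε, hεε₂, hεκ⟩ k hk
    rw [hΔ, hΔ]
    exact h2 ε hε hεε₂ (fun k => StochES.reducedTraj ς ϱ w₁ w₂ a ε (fun j => v j ω)
      (fun j => W j ω) (x ε) k) (fun _ => rfl) (hx ε hε hεκ).le k hk
  refine ⟨?_, fun N => ?_⟩
  · filter_upwards [hev] with ω hω
    exact StochES.tendsto_firstExit_top (hω 1)
  · refine StochES.tendsto_measure_one_of_ae_eventually (fun ε => ?_) ?_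
    · have hΔm : ∀ k, Measurable fun ω => ‖Δ ε ω k‖ := fun k => by
        simp only [hΔ]
        exact ((StochES.measurable_reducedTraj (hςd 2) ϱ w₁ w₂ a ε hvm hWm (x ε) k).sub_const
          e).norm
      simp only [Set.ofPred_forall]
      exact MeasurableSet.iInter fun k => MeasurableSet.iInter fun _ =>
        measurableSet_le (hΔm k) ((((hΔm 0).const_mul c).mul_const _).add_const δ)
    · filter_upwards [hev] with ω hω
      exact hω N
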